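/- For strings $T,T'$ let $ED(T,T')$ be the minimum number of single-symbol insertions and deletions transforming $T$ into $T'$, and let $S[i,j]$ be the contiguous substring of $S$ from position $i$ to position $j$, both included. For $\varepsilon\in(0,1)$, a string $S$ of length $n$ is an $\varepsilon$-synchronization string if $ED(S[i,j],S[j+1,k])>(1-\varepsilon)(k-i)$ for all $1\le i<j<k\le n$, and an $\varepsilon$-synchronization circle if for every $1\le i\le n$ the rotation $S_i,S_{i+1},\dots,S_n,S_1,\dots,S_{i-1}$ is an $\varepsilon$-synchronization string. **Theorem 4.5.** There are a deterministic algorithm, absolute constants $A,B,D>0$ and a polynomial $p$ such that, for every integer $n\ge 1$ and every real $\varepsilon\in(0,1)$, the algorithm constructs an $\varepsilon$-synchronization circle of length $n$ over an alphabet $\{0,\dots,q-1\}$ of size $q\le A\,\varepsilon^{-3}$ in time at most $$\Big(\frac{B}{\varepsilon^{2}}\Big)^{D\frac{\log n}{\varepsilon}}\cdot p\Big(\frac{\log n}{\varepsilon}\Big).$$ Moreover, for every fixed $\varepsilon\in(0,1)$ the running time of the same algorithm is at most polynomial in $n$. Here the algorithm is a single program for a random access machine whose only arithmetic operations are addition and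 truncated subtraction of natural numbers, every instruction and test costing one step. Its input consists of $n$ and natural numbers $a,b$ with $b>0$ and $\varepsilon/2\le a/b\le\varepsilon$ (for instance $a/b=\varepsilon$ when $\varepsilon$ is rational), and both claims hold for every such $a,b$. -/

import Mathlib

namespace SyncCircle

section Strings

variable {α : Type*}

/-- `Edits t S S'`: the string `S` can be transformed into `S'` by `t` single-symbol insertions
and deletions. -/
inductive Edits : ℕ → List α → List α → Prop
  | refl (S : List α) : Edits 0 S S
  | insert {t : ℕ} {S : List α} (u : List α) (a : α) (v : List α) :
      Edits t S (u ++ v) → Edits (t + 1) S (u ++ a :: v)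
  | delete {t : ℕ} {S : List α} (u : List α) (a : α) (v : List α) :
      Edits t S (u ++ a :: v) → Edits (t + 1) S (u ++ v)

theorem Edits.delete_append {t : ℕ} {S : List α} (u v : List α) (h : Edits t S (u ++ v)) :
    Edits (t + u.length) S v := by
  induction u generalizing t with
  | nil => simpa using h
  | cons a u ih =>
    have h' := ih (Edits.delete [] a (u ++ v) (by simpa using h))
    rw [List.length_cons]
    convert h' using 1
    omega

theorem Edits.insert_append {t : ℕ} {S : List α} (u v : List α) (h : Edits t S v) :
    Edits (t + u.length) S (u ++ v) := by
  induction u with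
  | nil => simpa using h
  | cons a u ih => exact Edits.insert [] a (u ++ v) ih

/-- Any string can be edited into any other one, so the minimum in `editDist` is attained. -/
theorem exists_edits (S S' : List α) : ∃ t, Edits t S S' := by
  have h1 : Edits (0 + S.length) S [] := Edits.delete_append S [] (by simpa using Edits.refl S)
  have h2 := Edits.insert_append S' [] h1
  exact ⟨_, by simpa using h2⟩

/-- The edit distance: the minimum number of insertions and deletions transforming `S` into
`S'`. -/
noncomputable def editDist (S S' : List α) : ℕ := sInf {t | Edits t S S'}

/-- `S[i, j]`: the contiguous substring from position `i` to position `j`, both included, where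
positions are counted from `1`. -/
def substr (S : List α) (i j : ℕ) : List α := (S.take j).drop (i - 1)

/-- `S` is an `ε`-synchronization string. -/
def IsSyncString (ε : ℝ) (S : List α) : Prop :=
  ∀ i j k : ℕ, 1 ≤ i → i < j → j < k → k ≤ S.length →
    (1 - ε) * ((k : ℝ) - (i : ℝ)) < (editDist (substr S i j) (substr S (j + 1) k) : ℝ)

/-- `S` is an `ε`-synchronization circle: for every `1 ≤ i ≤ n`, the rotation
`S_i, …, S_n, S_1, …, S_{i-1}` is an `ε`-synchronization string. -/
def IsSyncCircle (ε : ℝ) (S : List α) : Prop :=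
  ∀ i : ℕ, 1 ≤ i → i ≤ S.length → IsSyncString ε (S.rotate (i - 1))

end Strings

/-! The machine model: random access machines with unit-cost instructions whose only arithmetic
is addition and truncated subtraction. Control flow is structured (sequence, branch, loop), and
the random access memory is presented as a family of arrays. A program mentions only finitely
many registers and arrays. -/

/-- A memory state: registers holding natural numbers, and arrays of natural numbers
(`arr a x` is cell `x` of array `a`). -/
structure State where
  reg : ℕ → ℕ
  arr : ℕ → ℕ → ℕ

/-- Basic instructions. -/
inductive Instr
  /-- `R_i := c` -/
  | const (i c : ℕ)
  /-- `R_i := R_j + R_k` -/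
  | add (i j k : ℕ)
  /-- `R_i := R_j - R_k`, truncated at `0` -/
  | sub (i j k : ℕ)
  /-- `R_i := A_a[R_j]` -/
  | load (i a j : ℕ)
  /-- `A_a[R_i] := R_j` -/
  | store (a i j : ℕ)

/-- The effect of a basic instruction. -/
def Instr.exec : Instr → State → State
  | .const i c, s => { s with reg := Function.update s.reg i c }
  | .add i j k, s => { s with reg := Function.update s.reg i (s.reg j + s.reg k) }
  | .sub i j k, s => { s with reg := Function.update s.reg i (s.reg j - s.reg k) }
  | .load i a j, s => { s with reg := Function.update s.reg i (s.arr a (s.reg j)) }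
  | .store a i j, s =>
      { s with arr := Function.update s.arr a (Function.update (s.arr a) (s.reg i) (s.reg j)) }

/-- Programs. -/
inductive Prog
  | skip
  | basic (I : Instr)
  | seq (P Q : Prog)
  /-- if `R_i ≠ 0` then `P` else `Q` -/
  | branch (i : ℕ) (P Q : Prog)
  /-- while `R_i ≠ 0` do `P` -/
  | loop (i : ℕ) (P : Prog)

/-- `Run P s t s'`: started in state `s`, the program `P` halts in state `s'` after exactly `t`
steps; every executed basic instruction and every evaluated test counts as one step. -/
inductive Run : Prog → State → ℕ → State → Prop
  | skip (s : State) : Run .skip s 1 s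
  | basic (I : Instr) (s : State) : Run (.basic I) s 1 (I.exec s)
  | seq {P Q : Prog} {s s₁ s₂ : State} {t₁ t₂ : ℕ} :
      Run P s t₁ s₁ → Run Q s₁ t₂ s₂ → Run (.seq P Q) s (t₁ + t₂) s₂
  | branch_true {i : ℕ} {P Q : Prog} {s s₁ : State} {t : ℕ} :
      s.reg i ≠ 0 → Run P s t s₁ → Run (.branch i P Q) s (t + 1) s₁
  | branch_false {i : ℕ} {P Q : Prog} {s s₁ : State} {t : ℕ} :
      s.reg i = 0 → Run Q s t s₁ → Run (.branch i P Q) s (t + 1) s₁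
  | loop_done {i : ℕ} {P : Prog} {s : State} :
      s.reg i = 0 → Run (.loop i P) s 1 s
  | loop_step {i : ℕ} {P : Prog} {s s₁ s₂ : State} {t₁ t₂ : ℕ} :
      s.reg i ≠ 0 → Run P s t₁ s₁ → Run (.loop i P) s₁ t₂ s₂ →
        Run (.loop i P) s (t₁ + t₂ + 1) s₂

/-- Programs are deterministic: result and running time are determined by the start state. -/
theorem Run.deterministic {P : Prog} {s s₁ s₂ : State} {t₁ t₂ : ℕ}
    (h₁ : Run P s t₁ s₁) (h₂ : Run P s t₂ s₂) : t₁ = t₂ ∧ s₁ = s₂ := by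
  induction h₁ generalizing t₂ s₂ with
  | skip => cases h₂; exact ⟨rfl, rfl⟩
  | basic => cases h₂; exact ⟨rfl, rfl⟩
  | seq _ _ ih₁ ih₂ =>
    cases h₂ with
    | seq g₁ g₂ =>
      obtain ⟨rfl, rfl⟩ := ih₁ g₁
      obtain ⟨rfl, rfl⟩ := ih₂ g₂
      exact ⟨rfl, rfl⟩
  | branch_true h _ ih =>
    cases h₂ with
    | branch_true _ g => obtain ⟨rfl, rfl⟩ := ih g; exact ⟨rfl, rfl⟩
    | branch_false g => exact absurd g h
  | branch_false h _ ih =>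
    cases h₂ with
    | branch_true g => exact absurd h g
    | branch_false _ g => obtain ⟨rfl, rfl⟩ := ih g; exact ⟨rfl, rfl⟩
  | loop_done h =>
    cases h₂ with
    | loop_done => exact ⟨rfl, rfl⟩
    | loop_step g => exact absurd h g
  | loop_step h _ _ ih₁ ih₂ =>
    cases h₂ with
    | loop_done g => exact absurd g h
    | loop_step _ g₁ g₂ =>
      obtain ⟨rfl, rfl⟩ := ih₁ g₁
      obtain ⟨rfl, rfl⟩ := ih₂ g₂
      exact ⟨rfl, rfl⟩

/-- The start state on input `n` and the fraction `a / b`: registers `0`, `1`, `2` hold `n`, `a`,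
`b`, everything else is `0`. -/
def initState (n a b : ℕ) : State where
  reg := fun i => if i = 0 then n else if i = 1 then a else if i = 2 then b else 0
  arr := fun _ _ => 0

/-- The output string of length `n`: the first `n` cells of array `0`. -/
def State.output (s : State) (n : ℕ) : List ℕ := (List.range n).map (s.arr 0)

/-- `a / b` is an admissible description of the parameter `ε`: a fraction equal to `ε`, or, as is
unavoidable for irrational `ε`, approximating it from below up to a factor of `2`. -/
def Describes (a b : ℕ) (ε : ℝ) : Prop :=
  0 < b ∧ ε / 2 ≤ (a : ℝ) / (b : ℝ) ∧ (a : ℝ) / (b : ℝ) ≤ ε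

/-- Started on `n` and `a / b`, the program `P` halts after exactly `t` steps and outputs an
`ε`-synchronization circle of length `n` over the alphabet `{0, …, q - 1}`. -/
def Constructs (P : Prog) (n a b : ℕ) (ε : ℝ) (q t : ℕ) : Prop :=
  ∃ s : State, Run P (initState n a b) t s ∧
    ∃ S : List (Fin q), S.length = n ∧ s.output n = S.map Fin.val ∧ IsSyncCircle ε S

end SyncCircle

/-! The circle is cut into blocks of length `m = 8 * E * h`, where `E` is `b / a` rounded up and `h
= Nat.log 2 n + 1`; the last block may be truncated. Each block is internally synchronized with
factor `16 * E`, any two blocks have a common subsequence of length at most `2 * m / (16 * E)`, and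
shifting the base alphabet of size `q = 128 * (16 * E) ^ 3` by one of three colours makes cyclically
neighbouring blocks use disjoint alphabets. Edit distance enters only through common subsequences:
it suffices that two adjacent windows of total length `ℓ` on the circle never share a subsequence
longer than `ℓ / (2 * E)`.

That these local conditions imply the global one is `BlockString.le_of_matching`. If every matched
pair stays in one block, internal synchronization applies. Otherwise some pair joins equal symbols
of different blocks, and the colours force it to span at least `m`. A monotone matching meets few
pairs of blocks, about as many as the window has blocks, and each pair of blocks contributes at most
`2 * m / (16 * E)` matches. The boundary terms are multiples of `m`, hence absorbed by the window
length; the factor `16` against `2` pays for them.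

Good blocks exist by counting. `card_syncCodes_growth` shows that admissible strings multiply by at
least `q * (1 - 1 / (2 * F))` per added symbol: an extension that fails has a repeated subsequence
in its last positions, so many of its symbols are determined, and the induction hypothesis compares
such strings with the admissible prefixes. Thus at least a fraction `2 ^ (-h)` of all strings of
block length is admissible, while a union bound in `exists_code` shows that fewer are too close to
one of fewer than `2 ^ h` earlier blocks. Since `n < 2 ^ h`, every block can be chosen greedily.

The program performs this greedy choice by exhaustive search over the `q ^ m` codes, testing each
candidate by dynamic programming for longest common subsequences. All other work is polynomial in `q
^ m`, so a fixed power of `q ^ m` bounds the time; with `E ≤ 3 / ε` and `h = O(log n)` this yields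
both time bounds. When `n ≤ q` the symbols are simply all distinct, and `n = 1` is treated before
anything depending on `ε` is computed. -/

namespace SyncCircle

/-! ### Common subsequences and their maximal length -/

/-- The window `[i, j)` of `X` and the window `[l, k)` of `Y` have a common subsequence of
length `r`. -/
def HasMatching (X Y : ℕ → ℕ) (i j l k r : ℕ) : Prop :=
  ∃ f g : ℕ → ℕ,
    (∀ s < r, (i ≤ f s ∧ f s < j) ∧ (l ≤ g s ∧ g s < k) ∧ X (f s) = Y (g s)) ∧
    ∀ s t, s < t → t < r → f s < f t ∧ g s < g t

theorem HasMatching.mono {X Y : ℕ → ℕ} {i j l k r i' j' l' k' r' : ℕ}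
    (h : HasMatching X Y i j l k r) (hi : i' ≤ i) (hj : j ≤ j') (hl : l' ≤ l) (hk : k ≤ k')
    (hr : r' ≤ r) : HasMatching X Y i' j' l' k' r' := by
  obtain ⟨f, g, h1, h2⟩ := h
  refine ⟨f, g, fun s hs => ?_, fun s t hst ht => h2 s t hst (by omega)⟩
  have := h1 s (by omega)
  exact ⟨⟨by omega, by omega⟩, ⟨by omega, by omega⟩, this.2.2⟩

theorem HasMatching.congr {X Y X' Y' : ℕ → ℕ} {i j l k r : ℕ}
    (h : HasMatching X Y i j l k r) (hX : ∀ p, i ≤ p → p < j → X p = X' p)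
    (hY : ∀ p, l ≤ p → p < k → Y p = Y' p) : HasMatching X' Y' i j l k r := by
  obtain ⟨f, g, h1, h2⟩ := h
  refine ⟨f, g, fun s hs => ?_, h2⟩
  have := h1 s hs
  exact ⟨this.1, this.2.1, by rw [← hX _ this.1.1 this.1.2, ← hY _ this.2.1.1 this.2.1.2, this.2.2]⟩

theorem HasMatching.le_left {X Y : ℕ → ℕ} {i j l k r : ℕ} (h : HasMatching X Y i j l k r) :
    r ≤ j - i := by
  obtain ⟨f, g, h1, h2⟩ := h
  have : ((Finset.range r).image f).card ≤ (Finset.Ico i j).card := by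
    apply Finset.card_le_card
    intro x hx
    simp only [Finset.mem_image, Finset.mem_range] at hx
    obtain ⟨s, hs, rfl⟩ := hx
    simpa using (h1 s hs).1
  rw [Finset.card_image_of_injOn, Finset.card_range, Nat.card_Ico] at this
  · exact this
  · intro s hs t ht hst
    simp only [Finset.coe_range, Set.mem_Iio] at hs ht
    rcases lt_trichotomy s t with h | h | h
    · exact absurd hst (h2 s t h ht).1.ne
    · exact h
    · exact absurd hst (h2 t s h hs).1.ne'

theorem HasMatching.zero (X Y : ℕ → ℕ) (i j l k : ℕ) : HasMatching X Y i j l k 0 :=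
  ⟨id, id, fun _ hs => absurd hs (Nat.not_lt_zero _), fun _ _ _ ht => absurd ht (Nat.not_lt_zero _)⟩

theorem HasMatching.swap {X Y : ℕ → ℕ} {i j l k r : ℕ} (h : HasMatching X Y i j l k r) :
    HasMatching Y X l k i j r := by
  obtain ⟨f, g, h1, h2⟩ := h
  exact ⟨g, f, fun s hs => ⟨(h1 s hs).2.1, (h1 s hs).1, (h1 s hs).2.2.symm⟩,
    fun s t hst ht => (h2 s t hst ht).symm⟩

/-- Length of a longest common subsequence of `X i, …, X (i + x - 1)` and
`Y l, …, Y (l + y - 1)`. -/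
def lcs (X Y : ℕ → ℕ) (i l : ℕ) : ℕ → ℕ → ℕ
  | 0, _ => 0
  | _ + 1, 0 => 0
  | x + 1, y + 1 =>
    if X (i + x) = Y (l + y) then lcs X Y i l x y + 1
    else max (lcs X Y i l x (y + 1)) (lcs X Y i l (x + 1) y)

@[simp] theorem lcs_zero_right (X Y : ℕ → ℕ) (i l x : ℕ) : lcs X Y i l x 0 = 0 := by
  cases x <;> simp [lcs]

@[simp] theorem lcs_zero_left (X Y : ℕ → ℕ) (i l y : ℕ) : lcs X Y i l 0 y = 0 := by
  cases y <;> simp [lcs]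

theorem HasMatching.snoc {X Y : ℕ → ℕ} {i x l y r : ℕ}
    (h : HasMatching X Y i (i + x) l (l + y) r) (hxy : X (i + x) = Y (l + y)) :
    HasMatching X Y i (i + (x + 1)) l (l + (y + 1)) (r + 1) := by
  obtain ⟨f, g, h1, h2⟩ := h
  refine ⟨fun s => if s < r then f s else i + x, fun s => if s < r then g s else l + y, ?_, ?_⟩
  · intro s hs
    by_cases hsr : s < r
    · have := h1 s hsr
      simp only [hsr, if_true]
      refine ⟨⟨by omega, by omega⟩, ⟨by omega, by omega⟩, this.2.2⟩
    · simp only [hsr, if_false]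
      refine ⟨⟨by omega, by omega⟩, ⟨by omega, by omega⟩, hxy⟩
  · intro s t hst ht
    have hsr : s < r := by omega
    by_cases htr : t < r
    · simpa [hsr, htr] using h2 s t hst htr
    · have := h1 s hsr
      simp only [hsr, htr, if_true, if_false]
      omega

theorem hasMatching_lcs (X Y : ℕ → ℕ) (i l x y : ℕ) :
    HasMatching X Y i (i + x) l (l + y) (lcs X Y i l x y) := by
  induction x generalizing y with
  | zero => rw [lcs_zero_left]; exact HasMatching.zero ..
  | succ x ihx =>
    induction y with
    | zero => rw [lcs_zero_right]; exact HasMatching.zero ..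
    | succ y ihy =>
      rw [lcs]
      split_ifs with hxy
      · exact (ihx y).snoc hxy
      · rcases max_cases (lcs X Y i l x (y + 1)) (lcs X Y i l (x + 1) y) with h | h
        · rw [h.1]
          exact (ihx (y + 1)).mono le_rfl (by omega) le_rfl le_rfl le_rfl
        · rw [h.1]
          exact ihy.mono le_rfl le_rfl le_rfl (by omega) le_rfl

/-- If the final symbols agree, dropping the last pair leaves a matching of both shortened windows.
If they differ, the last pair misses one of the two ends, and by monotonicity so does the whole
matching. -/
theorem HasMatching.le_lcs {X Y : ℕ → ℕ} {i x l y r : ℕ}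
    (h : HasMatching X Y i (i + x) l (l + y) r) : r ≤ lcs X Y i l x y := by
  induction x generalizing y r with
  | zero => simpa using h.le_left
  | succ x ihx =>
    induction y generalizing r with
    | zero => simpa using h.swap.le_left
    | succ y ihy =>
      cases r with
      | zero => omega
      | succ r =>
        obtain ⟨f, g, h1, h2⟩ := h
        have hr := h1 r (by omega)
        rw [lcs]
        split_ifs with hxy
        · have : HasMatching X Y i (i + x) l (l + y) r := by
            refine ⟨f, g, fun s hs => ?_, fun s t hst ht => h2 s t hst (by omega)⟩
            have a1 := h1 s (by omega)
            have a2 := h2 s r hs (by omega)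
            exact ⟨⟨by omega, by omega⟩, ⟨by omega, by omega⟩, a1.2.2⟩
          exact Nat.succ_le_succ (ihx this)
        · by_cases hf : f r = i + x
          · have hg : g r ≠ l + y := fun hg => hxy (by rw [← hf, ← hg, hr.2.2])
            refine le_trans (ihy ⟨f, g, fun s hs => ?_, h2⟩) (le_max_right _ _)
            have a1 := h1 s hs
            have a2 : g s ≤ g r := by
              rcases Nat.lt_or_ge s r with h | h
              · exact (h2 s r h (by omega)).2.le
              · rw [show s = r by omega]
            exact ⟨⟨by omega, by omega⟩, ⟨by omega, by omega⟩, a1.2.2⟩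
          · refine le_trans (ihx ⟨f, g, fun s hs => ?_, h2⟩) (le_max_left _ _)
            have a1 := h1 s hs
            have a2 : f s ≤ f r := by
              rcases Nat.lt_or_ge s r with h | h
              · exact (h2 s r h (by omega)).1.le
              · rw [show s = r by omega]
            exact ⟨⟨by omega, by omega⟩, ⟨by omega, by omega⟩, a1.2.2⟩

/-! ### Matchings as pairs of position sets, and strings as numbers -/

/-- The increasing enumeration of a finite set of natural numbers. -/
noncomputable def enum (A : Finset ℕ) (s : ℕ) : ℕ :=
  if h : s < A.card then A.orderEmbOfFin rfl ⟨s, h⟩ else 0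

theorem enum_mem {A : Finset ℕ} {s : ℕ} (hs : s < A.card) : enum A s ∈ A := by
  rw [enum, dif_pos hs]; exact Finset.orderEmbOfFin_mem A rfl _

theorem enum_lt {A : Finset ℕ} {s t : ℕ} (hst : s < t) (ht : t < A.card) :
    enum A s < enum A t := by
  rw [enum, enum, dif_pos ht, dif_pos (hst.trans ht)]
  exact (A.orderEmbOfFin rfl).strictMono hst

theorem exists_enum_eq {A : Finset ℕ} {a : ℕ} (ha : a ∈ A) : ∃ s < A.card, enum A s = a := by
  have : a ∈ Set.range (A.orderEmbOfFin rfl) := by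
    rw [Finset.range_orderEmbOfFin]; exact ha
  obtain ⟨s, hs⟩ := this
  exact ⟨s, s.2, by rw [enum, dif_pos s.2]; exact hs⟩

theorem card_image_range {r : ℕ} {f : ℕ → ℕ} (hf : ∀ s t, s < t → t < r → f s < f t) :
    ((Finset.range r).image f).card = r := by
  rw [Finset.card_image_of_injOn, Finset.card_range]
  intro s hs t ht hst
  simp only [Finset.coe_range, Set.mem_Iio] at hs ht
  rcases lt_trichotomy s t with h | h | h
  · exact absurd hst (hf s t h ht).ne
  · exact h
  · exact absurd hst (hf t s h hs).ne'

theorem enum_image_range {r : ℕ} {f : ℕ → ℕ} (hf : ∀ s t, s < t → t < r → f s < f t) {s : ℕ}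
    (hs : s < r) : enum ((Finset.range r).image f) s = f s := by
  have hc := card_image_range hf
  have := Finset.orderEmbOfFin_unique (s := (Finset.range r).image f) rfl
    (f := fun x => f x) (fun x => Finset.mem_image_of_mem f (Finset.mem_range.2 (by
      have := x.2; omega))) (fun x y hxy => hf x y hxy (by have := y.2; omega))
  rw [enum, dif_pos (by omega), ← this]

/-- A matching depends only on its two sets of positions, so union bounds can range over pairs of
`r`-subsets and cost a squared binomial coefficient. -/
theorem HasMatching.exists_sets {X Y : ℕ → ℕ} {i j l k r : ℕ} (h : HasMatching X Y i j l k r) :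
    ∃ A ∈ (Finset.Ico i j).powersetCard r, ∃ B ∈ (Finset.Ico l k).powersetCard r,
      ∀ s < r, X (enum A s) = Y (enum B s) := by
  obtain ⟨f, g, h1, h2⟩ := h
  have hf := fun s t hst ht => (h2 s t hst ht).1
  have hg := fun s t hst ht => (h2 s t hst ht).2
  refine ⟨(Finset.range r).image f, ?_, (Finset.range r).image g, ?_, ?_⟩
  · rw [Finset.mem_powersetCard]
    refine ⟨fun x hx => ?_, card_image_range hf⟩
    simp only [Finset.mem_image, Finset.mem_range] at hx
    obtain ⟨s, hs, rfl⟩ := hx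
    simpa using (h1 s hs).1
  · rw [Finset.mem_powersetCard]
    refine ⟨fun x hx => ?_, card_image_range hg⟩
    simp only [Finset.mem_image, Finset.mem_range] at hx
    obtain ⟨s, hs, rfl⟩ := hx
    simpa using (h1 s hs).2.1
  · intro s hs
    rw [enum_image_range hf hs, enum_image_range hg hs]
    exact (h1 s hs).2.2

/-- The `p`-th digit of `c` in base `q`. -/
def digit (q c p : ℕ) : ℕ := c / q ^ p % q

theorem digit_lt {q : ℕ} (hq : 0 < q) (c p : ℕ) : digit q c p < q := Nat.mod_lt _ hq

theorem digit_mod {q c p m : ℕ} (hp : p < m) : digit q (c % q ^ m) p = digit q c p := by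
  unfold digit
  have h1 : q ^ m = q ^ p * q ^ (m - p) := by rw [← pow_add]; congr 1; omega
  rw [h1, Nat.mod_mul_right_div_self, Nat.mod_mod_of_dvd]
  exact dvd_pow_self q (by omega)

theorem digit_ext {q m c c' : ℕ} (hc : c < q ^ m) (hc' : c' < q ^ m)
    (h : ∀ p < m, digit q c p = digit q c' p) : c = c' := by
  rcases Nat.eq_zero_or_pos q with rfl | hq
  · rcases Nat.eq_zero_or_pos m with rfl | hm
    · simp at hc hc'; omega
    · rw [zero_pow (by omega)] at hc; omega
  induction m generalizing c c' with
  | zero => simp at hc hc'; omega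
  | succ m ih =>
    have h1 : c % q ^ m = c' % q ^ m := by
      apply ih (Nat.mod_lt _ (by positivity)) (Nat.mod_lt _ (by positivity))
      intro p hp
      rw [digit_mod hp, digit_mod hp]
      exact h p (by omega)
    have h2 := h m (by omega)
    unfold digit at h2
    rw [pow_succ] at hc hc'
    rw [Nat.mod_eq_of_lt (Nat.div_lt_of_lt_mul hc), Nat.mod_eq_of_lt (Nat.div_lt_of_lt_mul hc')]
      at h2
    rw [← Nat.div_add_mod c (q ^ m), ← Nat.div_add_mod c' (q ^ m), h1, h2]

/-- A set of codes whose lower `u` digits form a code from `G` and whose digits at `B` are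
determined by the others. -/
theorem card_le_of_determined {q M u r : ℕ} (hq : 0 < q) (P G B : Finset ℕ)
    (hB : B ∈ (Finset.Ico u M).powersetCard r) (hP : ∀ c ∈ P, c < q ^ M)
    (hG : ∀ c ∈ P, c % q ^ u ∈ G)
    (hdet : ∀ c ∈ P, ∀ c' ∈ P, (∀ p < M, p ∉ B → digit q c p = digit q c' p) →
      ∀ p ∈ B, digit q c p = digit q c' p) :
    P.card ≤ G.card * q ^ (M - u - r) := by
  classical
  rw [Finset.mem_powersetCard] at hB
  have hcard : (Finset.Ico u M \ B).card = M - u - r := by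
    rw [Finset.card_sdiff_of_subset hB.1, Nat.card_Ico, hB.2]
  have h1 : P.card ≤ (G ×ˢ (Finset.univ : Finset (↥(Finset.Ico u M \ B) → Fin q))).card := by
    apply Finset.card_le_card_of_injOn
      (fun c => ((c % q ^ u, fun p => ⟨digit q c p, digit_lt hq c p⟩) :
        ℕ × (↥(Finset.Ico u M \ B) → Fin q)))
    · intro c hc
      simp [hG c hc]
    · intro c hc c' hc' hcc
      simp only [Prod.mk.injEq] at hcc
      obtain ⟨e1, e2⟩ := hcc
      have key : ∀ p < M, p ∉ B → digit q c p = digit q c' p := by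
        intro p hp hpB
        by_cases hpu : p < u
        · rw [← digit_mod hpu, e1, digit_mod hpu]
        · have := congrFun e2 ⟨p, by simp [hpB, hp]; omega⟩
          simpa using this
      apply digit_ext (hP c hc) (hP c' hc')
      intro p hp
      by_cases hpB : p ∈ B
      · exact hdet c hc c' hc' key p hpB
      · exact key p hp hpB
  rwa [Finset.card_product, Finset.card_univ, Fintype.card_fun, Fintype.card_fin,
    Fintype.card_coe, hcard] at h1

/-! ### Counting admissible strings -/

/-- No two adjacent windows of total length `ℓ` inside `[u, v)` have a common subsequence of
length greater than `ℓ / F`. -/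
def SyncOn (F : ℕ) (X : ℕ → ℕ) (u v : ℕ) : Prop :=
  ∀ i j k r, u ≤ i → i ≤ j → j ≤ k → k ≤ v → HasMatching X X i j j k r → F * r ≤ k - i

open Classical in
/-- Codes of the strings of length `m` over `q` symbols satisfying `SyncOn`. -/
noncomputable def syncCodes (q F m : ℕ) : Finset ℕ :=
  (Finset.range (q ^ m)).filter fun c => SyncOn F (digit q c) 0 m

theorem mem_syncCodes {q F m c : ℕ} :
    c ∈ syncCodes q F m ↔ c < q ^ m ∧ SyncOn F (digit q c) 0 m := by
  simp [syncCodes]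

theorem SyncOn.mono {F : ℕ} {X : ℕ → ℕ} {u v u' v' : ℕ} (h : SyncOn F X u v) (hu : u ≤ u')
    (hv : v' ≤ v) : SyncOn F X u' v' :=
  fun i j k r hi hij hjk hk hm => h i j k r (hu.trans hi) hij hjk (hk.trans hv) hm

theorem mod_mem_syncCodes {q F m m' c : ℕ} (hq : 0 < q) (h : SyncOn F (digit q c) 0 m)
    (hm : m' ≤ m) : c % q ^ m' ∈ syncCodes q F m' := by
  rw [mem_syncCodes]
  refine ⟨Nat.mod_lt _ (by positivity), fun i j k r hi hij hjk hk hmat => ?_⟩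
  refine h i j k r hi hij hjk (hk.trans hm) (hmat.congr ?_ ?_)
  · exact fun p _ hp => digit_mod (by omega)
  · exact fun p _ hp => digit_mod (by omega)

open Classical in
/-- Codes of strings of length `M` with a common subsequence of length `r` of two adjacent windows
within the last `L` positions, the remaining prefix being admissible. -/
noncomputable def badCodes (q F M L r : ℕ) : Finset ℕ :=
  (Finset.range (q ^ M)).filter fun c => c % q ^ (M - L) ∈ syncCodes q F (M - L) ∧
    ∃ j, HasMatching (digit q c) (digit q c) (M - L) j j M r

/-- Fix the two position sets of the matching. The left one lies entirely before the right one, so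
the symbols on the right are copies of symbols that remain free; only `L - r` of the last `L`
symbols can be chosen. -/
theorem card_badCodes_le {q F M L r : ℕ} (hq : 0 < q) (hL : L ≤ M) :
    (badCodes q F M L r).card ≤
      L.choose r ^ 2 * ((syncCodes q F (M - L)).card * q ^ (L - r)) := by
  classical
  set W := (Finset.Ico (M - L) M).powersetCard r with hW
  have hWc : W.card = L.choose r := by
    rw [hW, Finset.card_powersetCard, Nat.card_Ico]; congr 1; omega
  let Q : Finset ℕ × Finset ℕ → Finset ℕ := fun AB =>
    (Finset.range (q ^ M)).filter fun c => c % q ^ (M - L) ∈ syncCodes q F (M - L) ∧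
      (∀ a ∈ AB.1, ∀ b ∈ AB.2, a < b) ∧
      ∀ s < r, digit q c (enum AB.1 s) = digit q c (enum AB.2 s)
  have hsub : badCodes q F M L r ⊆ (W ×ˢ W).biUnion Q := by
    intro c hc
    simp only [badCodes, Finset.mem_filter] at hc
    obtain ⟨hc1, hc2, j, hj⟩ := hc
    obtain ⟨A, hA, B, hB, hAB⟩ := hj.exists_sets
    rw [Finset.mem_powersetCard] at hA hB
    rcases Nat.eq_zero_or_pos r with hr | hr
    · subst hr
      have hA0 := Finset.card_eq_zero.1 hA.2
      have hB0 := Finset.card_eq_zero.1 hB.2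
      subst hA0 hB0
      simp only [Finset.mem_biUnion]
      exact ⟨(∅, ∅), by simp [hW], by
        simp only [Q, Finset.mem_filter]; exact ⟨hc1, hc2, by simp, by simp⟩⟩
    have hlt : ∀ a ∈ A, ∀ b ∈ B, a < b := by
      intro a ha b hb
      have h1 := Finset.mem_Ico.1 (hA.1 ha)
      have h2 := Finset.mem_Ico.1 (hB.1 hb)
      omega
    have hAne : A.Nonempty := Finset.card_pos.1 (by omega)
    have hBne : B.Nonempty := Finset.card_pos.1 (by omega)
    obtain ⟨a, ha⟩ := hAne
    obtain ⟨b, hb⟩ := hBne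
    have ha' := Finset.mem_Ico.1 (hA.1 ha)
    have hb' := Finset.mem_Ico.1 (hB.1 hb)
    simp only [Finset.mem_biUnion]
    refine ⟨(A, B), ?_, ?_⟩
    · rw [Finset.mem_product, hW, Finset.mem_powersetCard, Finset.mem_powersetCard]
      exact ⟨⟨hA.1.trans (Finset.Ico_subset_Ico le_rfl (by omega)), hA.2⟩,
        ⟨hB.1.trans (Finset.Ico_subset_Ico (by omega) le_rfl), hB.2⟩⟩
    · simp only [Q, Finset.mem_filter]
      exact ⟨hc1, hc2, hlt, hAB⟩
  refine (Finset.card_le_card hsub).trans ?_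
  rw [sq, ← hWc, ← Finset.card_product]
  apply Finset.card_biUnion_le_card_mul
  rintro ⟨A, B⟩ hAB
  rw [Finset.mem_product] at hAB
  have hA := Finset.mem_powersetCard.1 hAB.1
  have hB := Finset.mem_powersetCard.1 hAB.2
  have := card_le_of_determined hq (Q (A, B)) (syncCodes q F (M - L)) B hAB.2 ?_ ?_ ?_
  · rwa [show M - (M - L) = L by omega] at this
  · intro c hc
    simp only [Q, Finset.mem_filter, Finset.mem_range] at hc
    exact hc.1
  · intro c hc
    simp only [Q, Finset.mem_filter, Finset.mem_range] at hc
    exact hc.2.1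
  · intro c hc c' hc' hcc p hp
    simp only [Q, Finset.mem_filter, Finset.mem_range] at hc hc'
    obtain ⟨s, hs, rfl⟩ := exists_enum_eq hp
    simp only at hA hB
    have hsA : enum A s ∈ A := enum_mem (by omega)
    rw [← hc.2.2.2 s (by omega), ← hc'.2.2.2 s (by omega)]
    apply hcc
    · exact (Finset.mem_Ico.1 (hA.1 hsA)).2
    · exact fun h => lt_irrefl _ (hc.2.2.1 _ hsA _ h)

/-- Append an arbitrary symbol to an admissible string. If the result is not admissible, the
violating windows must end at the new symbol, and since they are shorter than `F * r` they lie in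
the last `min (F * r) (m + 1)` positions. -/
theorem mul_card_syncCodes_le {q F m : ℕ} (hq : 0 < q) (hF : 0 < F) :
    q * (syncCodes q F m).card ≤ (syncCodes q F (m + 1)).card +
      ∑ r ∈ Finset.Icc 1 (m + 1), (badCodes q F (m + 1) (min (F * r) (m + 1)) r).card := by
  classical
  have h1 : (Finset.range q ×ˢ syncCodes q F m).card ≤
      (syncCodes q F (m + 1) ∪ (Finset.Icc 1 (m + 1)).biUnion
        fun r => badCodes q F (m + 1) (min (F * r) (m + 1)) r).card := by
    -- The appended symbol becomes the digit of highest weight.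
    apply Finset.card_le_card_of_injOn (fun dc : ℕ × ℕ => dc.2 + q ^ m * dc.1)
    · rintro ⟨d, c⟩ hdc
      simp only [Finset.coe_product, Set.mem_prod, Finset.mem_coe, Finset.mem_range,
        mem_syncCodes] at hdc
      obtain ⟨hd, hc, hsync⟩ := hdc
      have hlt : c + q ^ m * d < q ^ (m + 1) := by
        rw [pow_succ]
        calc c + q ^ m * d < q ^ m + q ^ m * d := by omega
          _ = q ^ m * (d + 1) := by ring
          _ ≤ q ^ m * q := Nat.mul_le_mul_left _ hd
      have hmod : (c + q ^ m * d) % q ^ m = c := by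
        rw [Nat.add_mul_mod_self_left, Nat.mod_eq_of_lt hc]
      simp only [Finset.coe_union, Set.mem_union, Finset.mem_coe, mem_syncCodes,
        Finset.mem_biUnion]
      by_cases hs : SyncOn F (digit q (c + q ^ m * d)) 0 (m + 1)
      · exact Or.inl ⟨hlt, hs⟩
      · right
        have hsync' : SyncOn F (digit q (c + q ^ m * d)) 0 m := by
          intro i j k r hi hij hjk hk hmat
          refine hsync i j k r hi hij hjk hk (hmat.congr ?_ ?_)
          · intro p _ hp
            rw [← hmod, digit_mod (by omega), hmod]
          · intro p _ hp
            rw [← hmod, digit_mod (by omega), hmod]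
        unfold SyncOn at hs
        push Not at hs
        obtain ⟨i, j, k, r, hi, hij, hjk, hk, hmat, hlt'⟩ := hs
        have hk' : k = m + 1 := by
          by_contra hne
          exact absurd (hsync' i j k r hi hij hjk (by omega) hmat) (by omega)
        subst hk'
        have hr := hmat.le_left
        have hr0 : r ≠ 0 := by rintro rfl; simp at hlt'
        refine ⟨r, Finset.mem_Icc.2 ⟨by omega, by omega⟩, ?_⟩
        simp only [badCodes, Finset.mem_filter, Finset.mem_range]
        have hpos : 0 < F * r := Nat.mul_pos hF (by omega)
        exact ⟨hlt, mod_mem_syncCodes hq hsync' (by omega), j,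
          hmat.mono (by omega) le_rfl le_rfl le_rfl le_rfl⟩
    · rintro ⟨d, c⟩ hdc ⟨d', c'⟩ hdc' heq
      simp only [Finset.coe_product, Set.mem_prod, Finset.mem_coe, Finset.mem_range,
        mem_syncCodes] at hdc hdc' heq
      have h2 : c = c' := by
        have := congrArg (· % q ^ m) heq
        simpa [Nat.add_mul_mod_self_left, Nat.mod_eq_of_lt hdc.2.1, Nat.mod_eq_of_lt hdc'.2.1]
          using this
      subst h2
      have h3 : q ^ m * d = q ^ m * d' := by omega
      have h4 : d = d' := Nat.eq_of_mul_eq_mul_left (by positivity) h3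
      rw [h4]
  rw [Finset.card_product, Finset.card_range] at h1
  refine h1.trans ((Finset.card_union_le _ _).trans ?_)
  gcongr
  exact Finset.card_biUnion_le

/-- This is the usual bound by `(e * a) ^ r`, from `r ^ r / r! ≤ exp r`, with `e` rounded up to `3`.
-/
theorem choose_le_three_mul_pow {a r : ℕ} : ((a * r).choose r : ℝ) ≤ (3 * a) ^ r := by
  have h1 : ((a * r).choose r : ℝ) ≤ ((a * r : ℕ) : ℝ) ^ r / (r.factorial : ℝ) :=
    Nat.choose_le_pow_div _ _
  have h2 : (r : ℝ) ^ r / (r.factorial : ℝ) ≤ Real.exp r :=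
    Real.pow_div_factorial_le_exp _ (Nat.cast_nonneg r) r
  have h3 : Real.exp r ≤ 3 ^ r := by
    rw [← Real.exp_one_pow]
    exact pow_le_pow_left₀ (Real.exp_pos _).le Real.exp_one_lt_three.le _
  calc ((a * r).choose r : ℝ) ≤ ((a * r : ℕ) : ℝ) ^ r / (r.factorial : ℝ) := h1
    _ = (a : ℝ) ^ r * ((r : ℝ) ^ r / (r.factorial : ℝ)) := by push_cast; rw [mul_pow]; ring
    _ ≤ (a : ℝ) ^ r * 3 ^ r := by gcongr; exact h2.trans h3
    _ = (3 * a) ^ r := by rw [mul_pow]; ring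

theorem sum_geometric_le {x : ℝ} (hx : 0 ≤ x) (hx2 : x ≤ 1 / 2) (R : ℕ) :
    ∑ r ∈ Finset.Icc 1 R, x ^ r ≤ 2 * x := by
  have h : ∑ r ∈ Finset.Icc 1 R, x ^ r ≤ 2 * x - 2 * x ^ (R + 1) := by
    induction R with
    | zero => simp
    | succ R ih =>
      rw [Finset.sum_Icc_succ_top (by omega)]
      have : 0 ≤ x ^ (R + 1) := by positivity
      have e : x ^ (R + 1 + 1) = x ^ (R + 1) * x := pow_succ _ _
      nlinarith
  have : 0 ≤ x ^ (R + 1) := by positivity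
  linarith

theorem half_le_one_sub_pow {F : ℕ} (hF : 0 < F) :
    (1 : ℝ) / 2 ≤ (1 - 1 / (2 * (F : ℝ))) ^ F := by
  have hF1 : (1 : ℝ) ≤ F := by exact_mod_cast hF
  have h2 : 1 / (2 * (F : ℝ)) ≤ 1 / 2 := by
    apply one_div_le_one_div_of_le <;> linarith
  have := one_add_mul_le_pow (a := -(1 / (2 * (F : ℝ)))) (by linarith) F
  rw [← sub_eq_add_neg] at this
  refine le_trans (le_of_eq ?_) this
  field_simp
  norm_num

/-- Counting step: there are many admissible one-symbol extensions. -/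
theorem card_syncCodes_growth {F : ℕ} (hF : 0 < F) (m : ℕ) :
    -- All shorter lengths are compared at once because a failed extension is charged to a prefix up
    -- to `F * r` positions shorter.
    ∀ m' ≤ m, ((syncCodes (128 * F ^ 3) F m').card : ℝ) *
      ((128 * F ^ 3 : ℕ) * (1 - 1 / (2 * F)) : ℝ) ^ (m - m') ≤
        (syncCodes (128 * F ^ 3) F m).card := by
  set q := 128 * F ^ 3 with hqdef
  have hq : 0 < q := by positivity
  have hF1 : (1 : ℝ) ≤ F := by exact_mod_cast hF
  have hqR : (q : ℝ) = 128 * (F : ℝ) ^ 3 := by rw [hqdef]; push_cast; ring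
  set δ : ℝ := 1 - 1 / (2 * F) with hδ
  have hδ1 : (1 : ℝ) / 2 ≤ δ := by
    rw [hδ]
    have : 1 / (2 * (F : ℝ)) ≤ 1 / 2 := by
      apply one_div_le_one_div_of_le <;> linarith
    linarith
  have hδ2 : δ ≤ 1 := by
    rw [hδ]
    have : 0 ≤ 1 / (2 * (F : ℝ)) := by positivity
    linarith
  have hδF : (1 : ℝ) / 2 ≤ δ ^ F := half_le_one_sub_pow hF
  have hβ : (0 : ℝ) < q * δ := by
    have : (0 : ℝ) < q := by exact_mod_cast hq
    positivity
  induction m with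
  | zero =>
    intro m' hm'
    obtain rfl : m' = 0 := by omega
    simp
  | succ m ih =>
    suffices hstep : ((syncCodes q F m).card : ℝ) * (q * δ) ≤ (syncCodes q F (m + 1)).card by
      intro m' hm'
      rcases Nat.lt_or_ge m m' with h | h
      · obtain rfl : m' = m + 1 := by omega
        simp
      · rw [show m + 1 - m' = (m - m') + 1 by omega, pow_succ, ← mul_assoc]
        exact (mul_le_mul_of_nonneg_right (ih m' h) hβ.le).trans hstep
    set f : ℝ := ((syncCodes q F m).card : ℝ) with hf
    have hf0 : 0 ≤ f := Nat.cast_nonneg _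
    have hqpos : (0 : ℝ) < q := by exact_mod_cast hq
    have hbad : ∀ r ∈ Finset.Icc 1 (m + 1),
        ((badCodes q F (m + 1) (min (F * r) (m + 1)) r).card : ℝ) ≤
          q * f * (18 * (F : ℝ) ^ 2 / q) ^ r := by
      intro r hr
      rw [Finset.mem_Icc] at hr
      set L := min (F * r) (m + 1) with hL
      have hLm : L ≤ m + 1 := min_le_right _ _
      have hLF : L ≤ F * r := min_le_left _ _
      have hrF : r ≤ F * r := Nat.le_mul_of_pos_left r hF
      have hrL : r ≤ L := le_min hrF hr.2
      have h1 : ((badCodes q F (m + 1) L r).card : ℝ) ≤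
          (L.choose r : ℝ) ^ 2 * ((syncCodes q F (m + 1 - L)).card * (q : ℝ) ^ (L - r)) := by
        exact_mod_cast card_badCodes_le hq hLm
      have h2 : (L.choose r : ℝ) ≤ (3 * F) ^ r :=
        le_trans (by exact_mod_cast Nat.choose_le_choose r hLF) choose_le_three_mul_pow
      have h3 : ((syncCodes q F (m + 1 - L)).card : ℝ) * (q * δ) ^ (L - 1) ≤ f := by
        have := ih (m + 1 - L) (by omega)
        rwa [show m - (m + 1 - L) = L - 1 by omega] at this
      -- The loss factor `δ` accumulated over at most `F * r` positions costs only `2 ^ r`, by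
      -- Bernoulli's inequality.
      have h4 : (1 : ℝ) ≤ 2 ^ r * δ ^ (L - 1) := by
        have e1 : δ ^ (F * r) ≤ δ ^ (L - 1) :=
          pow_le_pow_of_le_one (by linarith) hδ2 (by omega)
        have e2 : (1 / 2 : ℝ) ^ r ≤ δ ^ (F * r) := by
          rw [pow_mul]; exact pow_le_pow_left₀ (by norm_num) hδF r
        calc (1 : ℝ) = 2 ^ r * (1 / 2) ^ r := by rw [← mul_pow]; norm_num
          _ ≤ 2 ^ r * δ ^ (L - 1) := by gcongr; exact e2.trans e1
      set g : ℝ := ((syncCodes q F (m + 1 - L)).card : ℝ) with hg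
      have hg0 : 0 ≤ g := Nat.cast_nonneg _
      have h5 : g * (q : ℝ) ^ (L - 1) ≤ 2 ^ r * f := by
        calc g * (q : ℝ) ^ (L - 1) ≤ g * (q : ℝ) ^ (L - 1) * (2 ^ r * δ ^ (L - 1)) :=
              le_mul_of_one_le_right (by positivity) h4
          _ = 2 ^ r * (g * (q * δ) ^ (L - 1)) := by rw [mul_pow]; ring
          _ ≤ 2 ^ r * f := by gcongr
      have h6 : (q : ℝ) ^ (L - r) * q ^ r = q ^ (L - 1) * q := by
        rw [← pow_add, ← pow_succ]; congr 1; omega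
      have h7 : g * (q : ℝ) ^ (L - r) ≤ q * f * (2 / q) ^ r := by
        rw [div_pow, mul_div_assoc', le_div_iff₀ (by positivity)]
        calc g * (q : ℝ) ^ (L - r) * q ^ r = (g * q ^ (L - 1)) * q := by
              rw [mul_assoc, h6]; ring
          _ ≤ (2 ^ r * f) * q := by gcongr
          _ = q * f * 2 ^ r := by ring
      calc ((badCodes q F (m + 1) L r).card : ℝ)
          ≤ (L.choose r : ℝ) ^ 2 * (g * (q : ℝ) ^ (L - r)) := h1
        _ ≤ ((3 * F) ^ r) ^ 2 * (q * f * (2 / q) ^ r) := by gcongr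
        _ = q * f * (18 * (F : ℝ) ^ 2 / q) ^ r := by
          rw [← pow_mul, mul_comm r 2, pow_mul, ← mul_assoc, mul_comm _ ((q : ℝ) * f), mul_assoc,
            ← mul_pow]
          congr 2; ring
    -- The `18` is `9 * 2`: the squared binomial bound gives `(9 * F ^ 2) ^ r`, the determined
    -- symbols and the accumulated loss give `(2 / q) ^ r`. The cubic alphabet makes the ratio of
    -- order `1 / F`, so the whole geometric sum stays below `1 / (2 * F)`.
    have hx : 18 * (F : ℝ) ^ 2 / q = 18 / 128 / F := by
      rw [hqR]; field_simp
    have hmain : (q : ℝ) * f ≤ (syncCodes q F (m + 1)).card +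
        ∑ r ∈ Finset.Icc 1 (m + 1), q * f * (18 * (F : ℝ) ^ 2 / q) ^ r := by
      have h1 : (q : ℝ) * f ≤ (syncCodes q F (m + 1)).card +
          ∑ r ∈ Finset.Icc 1 (m + 1),
            ((badCodes q F (m + 1) (min (F * r) (m + 1)) r).card : ℝ) := by
        rw [hf]; exact_mod_cast mul_card_syncCodes_le (q := q) (F := F) (m := m) hq hF
      exact h1.trans (by gcongr with r hr; exact hbad r hr)
    rw [← Finset.mul_sum, hx] at hmain
    have hgeo := sum_geometric_le (x := 18 / 128 / F) (by positivity)
      (by rw [div_le_iff₀ (by linarith)]; linarith) (m + 1)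
    have h8 : 2 * (18 / 128 / (F : ℝ)) ≤ 1 / (2 * F) := by
      rw [div_div, mul_div_assoc', div_le_div_iff₀ (by positivity) (by positivity)]
      nlinarith
    have h9 : (q : ℝ) * f * ∑ r ∈ Finset.Icc 1 (m + 1), (18 / 128 / (F : ℝ)) ^ r ≤
        q * f * (1 / (2 * F)) := by
      gcongr
      exact hgeo.trans h8
    have : f * (q * δ) = q * f - q * f * (1 / (2 * F)) := by rw [hδ]; ring
    rw [this]
    linarith

/-- Among the admissible strings of length `a * h` there is one with only short common subsequences
with `t < 2 ^ h` given strings. -/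
theorem exists_code {a h t : ℕ} (ha : 0 < a) (ht : t < 2 ^ h) (X : ℕ → ℕ) (off : ℕ) :
    ∃ c < (128 * (2 * a) ^ 3) ^ (a * h),
      SyncOn (2 * a) (digit (128 * (2 * a) ^ 3) c) 0 (a * h) ∧
      ∀ s < t, ∀ r, HasMatching X (fun p => digit (128 * (2 * a) ^ 3) c p + off)
        (s * (a * h)) (s * (a * h) + a * h) 0 (a * h) r → r ≤ h := by
  classical
  set q := 128 * (2 * a) ^ 3 with hqdef
  set m := a * h with hm
  have hq : 0 < q := by positivity
  have hhm : h ≤ m := Nat.le_mul_of_pos_left h ha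
  let bad : ℕ → Finset ℕ := fun s => (Finset.range (q ^ m)).filter fun c =>
    HasMatching X (fun p => digit q c p + off) (s * m) (s * m + m) 0 m h
  have hcard : ∀ s, (bad s).card ≤ m.choose h ^ 2 * q ^ (m - h) := by
    intro s
    let Q : Finset ℕ × Finset ℕ → Finset ℕ := fun AB =>
      (Finset.range (q ^ m)).filter fun c =>
        ∀ s < h, X (enum AB.1 s) = digit q c (enum AB.2 s) + off
    have hsub : bad s ⊆ ((Finset.Ico (s * m) (s * m + m)).powersetCard h ×ˢ
        (Finset.Ico 0 m).powersetCard h).biUnion Q := by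
      intro c hc
      simp only [bad, Finset.mem_filter] at hc
      obtain ⟨A, hA, B, hB, hAB⟩ := hc.2.exists_sets
      simp only [Finset.mem_biUnion]
      refine ⟨(A, B), Finset.mem_product.2 ⟨hA, hB⟩, ?_⟩
      simp only [Q, Finset.mem_filter]
      exact ⟨hc.1, hAB⟩
    refine (Finset.card_le_card hsub).trans ?_
    refine (Finset.card_biUnion_le_card_mul _ _ (q ^ (m - h)) ?_).trans (le_of_eq ?_)
    · rintro ⟨A, B⟩ hAB
      have hB := (Finset.mem_product.1 hAB).2
      have := card_le_of_determined hq (Q (A, B)) {0} B hB ?_ ?_ ?_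
      · simpa using this
      · intro c hc
        simp only [Q, Finset.mem_filter, Finset.mem_range] at hc
        exact hc.1
      · intro c _
        simp [Nat.mod_one]
      · intro c hc c' hc' _ p hp
        simp only [Q, Finset.mem_filter, Finset.mem_range] at hc hc'
        obtain ⟨s, hs, rfl⟩ := exists_enum_eq hp
        have hB' := (Finset.mem_powersetCard.1 hB).2
        have h1 := hc.2 s (by simp only at hB'; omega)
        have h2 := hc'.2 s (by simp only at hB'; omega)
        omega
    · rw [Finset.card_product, Finset.card_powersetCard, Finset.card_powersetCard, Nat.card_Ico,
        Nat.card_Ico, sq]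
      simp
  -- The empty string is admissible, which starts the growth estimate.
  have hf0 : 1 ≤ (syncCodes q (2 * a) 0).card := by
    apply Finset.card_pos.2
    refine ⟨0, mem_syncCodes.2 ⟨by simp, fun i j k r _ hij hjk hk hmat => ?_⟩⟩
    have := hmat.le_left
    obtain rfl : r = 0 := by omega
    simp
  have hgrow := card_syncCodes_growth (F := 2 * a) (by omega) m 0 (Nat.zero_le _)
  have hhalf := half_le_one_sub_pow (F := 2 * a) (by omega)
  rw [← hqdef, Nat.sub_zero, mul_pow] at hgrow
  have hqpos : (0 : ℝ) < q := by exact_mod_cast hq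
  have haR : (1 : ℝ) ≤ a := by exact_mod_cast ha
  have hδm : (1 / 2 : ℝ) ^ h ≤ (1 - 1 / (2 * ((2 * a : ℕ) : ℝ))) ^ m := by
    have h1 : 1 / (2 * ((2 * a : ℕ) : ℝ)) ≤ 1 := by
      push_cast
      rw [div_le_one (by positivity)]
      linarith
    have h2 : 0 ≤ 1 / (2 * ((2 * a : ℕ) : ℝ)) := by positivity
    calc (1 / 2 : ℝ) ^ h ≤ ((1 - 1 / (2 * ((2 * a : ℕ) : ℝ))) ^ (2 * a)) ^ h :=
          pow_le_pow_left₀ (by norm_num) hhalf h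
      _ = (1 - 1 / (2 * ((2 * a : ℕ) : ℝ))) ^ (2 * a * h) := (pow_mul _ _ _).symm
      _ ≤ _ := by
        apply pow_le_pow_of_le_one (by linarith) (by linarith)
        rw [hm, mul_assoc]; omega
  -- The block length `a * h` is only half of `F * h` for `F = 2 * a`, so the total loss is at most
  -- `2 ^ h`.
  have hlow : (q : ℝ) ^ m * (1 / 2) ^ h ≤ (syncCodes q (2 * a) m).card := by
    refine le_trans ?_ hgrow
    have : (1 : ℝ) ≤ (syncCodes q (2 * a) 0).card := by exact_mod_cast hf0
    calc (q : ℝ) ^ m * (1 / 2) ^ h = 1 * ((q : ℝ) ^ m * (1 / 2) ^ h) := (one_mul _).symm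
      _ ≤ _ := by gcongr
  have hch : (m.choose h : ℝ) ≤ (3 * a) ^ h := choose_le_three_mul_pow
  have hlt : ((Finset.range t).biUnion bad).card < (syncCodes q (2 * a) m).card := by
    have h1 : ((Finset.range t).biUnion bad).card ≤ t * (m.choose h ^ 2 * q ^ (m - h)) := by
      simpa using Finset.card_biUnion_le_card_mul (Finset.range t) bad _ fun s _ => hcard s
    have h2 : (((Finset.range t).biUnion bad).card : ℝ) ≤
        t * ((m.choose h : ℝ) ^ 2 * (q : ℝ) ^ (m - h)) := by exact_mod_cast h1
    have h3 : (t : ℝ) < 2 ^ h := by exact_mod_cast ht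
    have hq36 : 36 * (a : ℝ) ^ 2 ≤ q := by
      rw [hqdef]; push_cast
      nlinarith [sq_nonneg (a : ℝ), mul_le_mul_of_nonneg_left haR (sq_nonneg (a : ℝ))]
    -- Each given string excludes at most a fraction `4 ^ (-h)`; fewer than `2 ^ h` of them exclude
    -- less than the admissible fraction `2 ^ (-h)`.
    have h4 : (m.choose h : ℝ) ^ 2 * (q : ℝ) ^ (m - h) ≤ q ^ m * (1 / 4) ^ h := by
      calc (m.choose h : ℝ) ^ 2 * (q : ℝ) ^ (m - h) ≤ ((3 * a) ^ h) ^ 2 * (q : ℝ) ^ (m - h) := by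
            gcongr
        _ = (36 * (a : ℝ) ^ 2) ^ h * (1 / 4) ^ h * (q : ℝ) ^ (m - h) := by
            rw [← pow_mul, mul_comm h 2, pow_mul, ← mul_pow]
            congr 2; ring
        _ ≤ (q : ℝ) ^ h * (1 / 4) ^ h * (q : ℝ) ^ (m - h) := by gcongr
        _ = (q : ℝ) ^ (h + (m - h)) * (1 / 4) ^ h := by rw [pow_add]; ring
        _ = q ^ m * (1 / 4) ^ h := by rw [Nat.add_sub_cancel' hhm]
    have h5 : (t : ℝ) * ((m.choose h : ℝ) ^ 2 * (q : ℝ) ^ (m - h)) < q ^ m * (1 / 2) ^ h := by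
      calc (t : ℝ) * ((m.choose h : ℝ) ^ 2 * (q : ℝ) ^ (m - h))
          ≤ t * (q ^ m * (1 / 4) ^ h) := by gcongr
        _ < 2 ^ h * (q ^ m * (1 / 4) ^ h) := by gcongr
        _ = q ^ m * (2 * (1 / 4)) ^ h := by rw [mul_pow]; ring
        _ = q ^ m * (1 / 2) ^ h := by norm_num
    exact_mod_cast h2.trans_lt (h5.trans_le hlow)
  obtain ⟨c, hc, hcb⟩ := Finset.exists_mem_notMem_of_card_lt_card hlt
  rw [mem_syncCodes] at hc
  refine ⟨c, hc.1, hc.2, fun s hs r hr => ?_⟩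
  by_contra hlt'
  apply hcb
  simp only [Finset.mem_biUnion, Finset.mem_range]
  refine ⟨s, hs, ?_⟩
  simp only [bad, Finset.mem_filter, Finset.mem_range]
  exact ⟨hc.1, hr.mono le_rfl le_rfl le_rfl le_rfl (by omega)⟩

theorem HasMatching.of_finset {X Y : ℕ → ℕ} {i j l k : ℕ} (T : Finset ℕ) (f g : ℕ → ℕ)
    (h1 : ∀ s ∈ T, (i ≤ f s ∧ f s < j) ∧ (l ≤ g s ∧ g s < k) ∧ X (f s) = Y (g s))
    (h2 : ∀ s ∈ T, ∀ t ∈ T, s < t → f s < f t ∧ g s < g t) :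
    HasMatching X Y i j l k T.card :=
  ⟨fun s => f (enum T s), fun s => g (enum T s), fun _ hs => h1 _ (enum_mem hs),
    fun _ _ hst ht => h2 _ (enum_mem (hst.trans ht)) _ (enum_mem ht) (enum_lt hst ht)⟩

/-! ### Matchings on a circle of coloured blocks -/

/-- Index of the block of position `u` of the string read twice around the circle of length `n`. -/
def extBlock (n m u : ℕ) : ℕ := if u < n then u / m else (n + m - 1) / m + (u - n) / m

/-- Position on the circle of length `n` of a position `u < 2 * n`. -/
def circlePos (n u : ℕ) : ℕ := if u < n then u else u - n

theorem circlePos_lt {n u : ℕ} (hu : u < 2 * n) : circlePos n u < n := by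
  unfold circlePos; split_ifs <;> omega

theorem circlePos_eq_mod {n u : ℕ} (hu : u < 2 * n) : circlePos n u = u % n := by
  unfold circlePos
  split_ifs with h
  · exact (Nat.mod_eq_of_lt h).symm
  · rw [Nat.mod_eq_sub_mod (by omega), Nat.mod_eq_of_lt (by omega)]

theorem div_lt_blockCount {n m u : ℕ} (hm : 0 < m) (hu : u < n) : u / m < (n + m - 1) / m := by
  have h := Nat.div_add_mod (n + m - 1) m
  have h' := Nat.mod_lt (n + m - 1) hm
  rw [Nat.div_lt_iff_lt_mul hm, mul_comm]
  omega

theorem extBlock_mono {n m u v : ℕ} (hm : 0 < m) (huv : u ≤ v) :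
    extBlock n m u ≤ extBlock n m v := by
  unfold extBlock
  split_ifs with h1 h2
  · exact Nat.div_le_div_right huv
  · exact (div_lt_blockCount hm h1).le.trans (Nat.le_add_right _ _)
  · omega
  · exact Nat.add_le_add_left (Nat.div_le_div_right (by omega)) _

/-- Partial blocks at the two ends account for one `m`; the possibly truncated block before the seam
of the circle accounts for the other. -/
theorem extBlock_mul_le {n m u v : ℕ} (hm : 0 < m) (huv : u ≤ v) :
    extBlock n m v * m ≤ extBlock n m u * m + (v - u) + 2 * m := by
  have a1 := Nat.div_add_mod u m
  have a2 := Nat.mod_lt u hm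
  have b1 := Nat.div_add_mod v m
  have b2 := Nat.mod_lt v hm
  have c1 := Nat.div_add_mod (u - n) m
  have c2 := Nat.mod_lt (u - n) hm
  have d1 := Nat.div_add_mod (v - n) m
  have d2 := Nat.mod_lt (v - n) hm
  have e1 := Nat.div_add_mod (n + m - 1) m
  have e2 := Nat.mod_lt (n + m - 1) hm
  rw [mul_comm] at a1 b1 c1 d1 e1
  unfold extBlock
  split_ifs <;> (try simp only [Nat.add_mul]) <;> omega

theorem extBlock_eq {n m u v : ℕ} (hm : 0 < m) (h : extBlock n m u = extBlock n m v) :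
    (u < n ↔ v < n) ∧ circlePos n u / m = circlePos n v / m := by
  unfold extBlock at h
  unfold circlePos
  split_ifs at h ⊢ with h1 h2 h2
  · exact ⟨by simp [h1, h2], h⟩
  · exact absurd h ((div_lt_blockCount hm h1).trans_le (Nat.le_add_right _ _)).ne
  · exact absurd h ((div_lt_blockCount hm h2).trans_le (Nat.le_add_right _ _)).ne'
  · exact ⟨by simp [h1, h2], by omega⟩

/-- Colour of a block. -/
def colour (t : ℕ) : ℕ := if t = 0 then 2 else (t + 1) % 2

theorem mem_block {m p : ℕ} (hm : 0 < m) : p / m * m ≤ p ∧ p < p / m * m + m := by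
  have h1 := Nat.div_add_mod p m
  have h2 := Nat.mod_lt p hm
  rw [mul_comm] at h1
  omega

section Circle

variable {n m E : ℕ} {X : ℕ → ℕ}

/-- A string of length `n` made of blocks of length `m` (the last one possibly truncated) that are
internally synchronized, mutually far apart, and coloured. -/
structure BlockString (E n m : ℕ) (X : ℕ → ℕ) : Prop where
  pos : 0 < m
  le : 2 * m ≤ n
  sync : ∀ t, t * m < n → SyncOn (16 * E) X (t * m) (t * m + m)
  far : ∀ s t, s < t → t * m < n → ∀ r,
    HasMatching X X (s * m) (s * m + m) (t * m) (t * m + m) r → 16 * E * r ≤ 2 * m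
  col : ∀ u v, u < n → v < n → X u = X v → colour (u / m) = colour (v / m)

/-- Neighbouring blocks differ in colour, so equal symbols in different blocks have a full block
between them. The third colour, used by block `0` alone, handles the seam, where the last block may
be too short to act as a separator. -/
theorem BlockString.le_sub (h : BlockString E n m X) {u v : ℕ} (huv : u < v)
    (hu : u < 2 * n) (hv2 : v < 2 * n) (hX : X (circlePos n u) = X (circlePos n v))
    (hne : extBlock n m u ≠ extBlock n m v) : m ≤ v - u := by
  have hm := h.pos
  have hnm := h.le
  have hc := h.col _ _ (circlePos_lt hu) (circlePos_lt hv2) hX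
  have key : ∀ a b, a < b → a / m ≠ b / m → colour (a / m) = colour (b / m) → m ≤ b - a := by
    intro a b hab hne hc
    have h1 : a / m ≤ b / m := Nat.div_le_div_right hab.le
    have h2 : a / m + 2 ≤ b / m := by
      unfold colour at hc
      split_ifs at hc <;> omega
    have h3 := mem_block (p := a) hm
    have h4 := mem_block (p := b) hm
    have h5 : (a / m + 2) * m ≤ b / m * m := Nat.mul_le_mul_right m h2
    rw [Nat.add_mul] at h5
    omega
  unfold extBlock at hne
  unfold circlePos at hc
  split_ifs at hne hc with h1 h2
  · exact key u v huv hne hc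
  · by_cases hv0 : (v - n) / m = 0
    · have hu0 : u / m = 0 := by
        rw [hv0] at hc
        unfold colour at hc
        split_ifs at hc <;> omega
      rw [Nat.div_eq_zero_iff_lt hm] at hu0
      omega
    · have : m ≤ v - n := by
        by_contra hlt
        exact hv0 (Nat.div_eq_of_lt (by omega))
      omega
  · omega
  · have := key (u - n) (v - n) (by omega) (by omega) hc
    omega

/-- For two different blocks this is the condition `far`. If both sides project to the same block, a
cut point separates their positions there and `sync` applies; when the window wraps around into its
starting block, the cut is `x` and the two sides exchange roles. -/
theorem BlockString.fiber (h : BlockString E n m X) {x y r : ℕ} (hx : x < n)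
    {f g : ℕ → ℕ}
    (h1 : ∀ s < r, (x ≤ f s ∧ f s < y) ∧ (y ≤ g s ∧ g s < x + n) ∧
      X (circlePos n (f s)) = X (circlePos n (g s)))
    (h2 : ∀ s t, s < t → t < r → f s < f t ∧ g s < g t) (T : Finset ℕ) (hT : ∀ s ∈ T, s < r)
    (e₁ e₂ : ℕ) (hT1 : ∀ s ∈ T, extBlock n m (f s) = e₁) (hT2 : ∀ s ∈ T, extBlock n m (g s) = e₂) :
    16 * E * T.card ≤ 2 * m := by
  have hm := h.pos
  rcases T.eq_empty_or_nonempty with rfl | ⟨s0, hs0⟩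
  · simp
  have hs0r := h1 s0 (hT s0 hs0)
  set b := circlePos n (f s0) / m with hb
  set c := circlePos n (g s0) / m with hc
  have hfb : ∀ s ∈ T, (f s < n ↔ f s0 < n) ∧ circlePos n (f s) / m = b := fun s hs =>
    extBlock_eq hm ((hT1 s hs).trans (hT1 s0 hs0).symm)
  have hgc : ∀ s ∈ T, (g s < n ↔ g s0 < n) ∧ circlePos n (g s) / m = c := fun s hs =>
    extBlock_eq hm ((hT2 s hs).trans (hT2 s0 hs0).symm)
  have hfblk : ∀ s ∈ T, b * m ≤ circlePos n (f s) ∧ circlePos n (f s) < b * m + m := fun s hs => by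
    rw [← (hfb s hs).2]; exact mem_block hm
  have hgblk : ∀ s ∈ T, c * m ≤ circlePos n (g s) ∧ circlePos n (g s) < c * m + m := fun s hs => by
    rw [← (hgc s hs).2]; exact mem_block hm
  have hmono : ∀ s ∈ T, ∀ t ∈ T, s < t → circlePos n (f s) < circlePos n (f t) ∧
      circlePos n (g s) < circlePos n (g t) := by
    intro s hs t ht hst
    have := h2 s t hst (hT t ht)
    have a1 := (hfb s hs).1
    have a2 := (hfb t ht).1
    have a3 := (hgc s hs).1
    have a4 := (hgc t ht).1
    unfold circlePos
    constructor
    · split_ifs <;> omega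
    · split_ifs <;> omega
  have hbn : b * m < n := (hfblk s0 hs0).1.trans_lt (circlePos_lt (by omega))
  have hcn : c * m < n := (hgblk s0 hs0).1.trans_lt (circlePos_lt (by omega))
  have hmat : HasMatching X X (b * m) (b * m + m) (c * m) (c * m + m) T.card :=
    HasMatching.of_finset T (fun s => circlePos n (f s)) (fun s => circlePos n (g s))
      (fun s hs => ⟨hfblk s hs, hgblk s hs, (h1 s (hT s hs)).2.2⟩) hmono
  rcases lt_trichotomy b c with hlt | heq | hgt
  · exact h.far b c hlt hcn _ hmat
  · suffices ∃ w, b * m ≤ w ∧ w ≤ b * m + m ∧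
        ((∀ s ∈ T, circlePos n (f s) < w ∧ w ≤ circlePos n (g s)) ∨
        (∀ s ∈ T, circlePos n (g s) < w ∧ w ≤ circlePos n (f s))) by
      obtain ⟨w, hw1, hw2, hw⟩ := this
      have hsync := h.sync b hbn
      rw [← heq] at hgblk
      have : 16 * E * T.card ≤ b * m + m - b * m := by
        rcases hw with hw | hw
        · exact hsync _ w _ _ le_rfl hw1 hw2 le_rfl (HasMatching.of_finset T
            (fun s => circlePos n (f s)) (fun s => circlePos n (g s))
            (fun s hs => ⟨⟨(hfblk s hs).1, (hw s hs).1⟩, ⟨(hw s hs).2, (hgblk s hs).2⟩,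
              (h1 s (hT s hs)).2.2⟩) hmono)
        · exact hsync _ w _ _ le_rfl hw1 hw2 le_rfl (HasMatching.of_finset T
            (fun s => circlePos n (g s)) (fun s => circlePos n (f s))
            (fun s hs => ⟨⟨(hgblk s hs).1, (hw s hs).1⟩, ⟨(hw s hs).2, (hfblk s hs).2⟩,
              (h1 s (hT s hs)).2.2.symm⟩) (fun s hs t ht hst => (hmono s hs t ht hst).symm))
      omega
    have q1 := hfblk s0 hs0
    have q2 := hgblk s0 hs0
    rw [← heq] at q2
    by_cases hg : g s0 < n
    · have hf : f s0 < n := by omega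
      refine ⟨y, ?_, ?_, Or.inl fun s hs => ?_⟩
      · simp only [circlePos, hf, if_true] at q1; omega
      · simp only [circlePos, hg, if_true] at q2; omega
      · have a1 := (hfb s hs).1.2 hf
        have a2 := (hgc s hs).1.2 hg
        have := h1 s (hT s hs)
        simp only [circlePos, a1, a2, if_true]
        omega
    · by_cases hf : f s0 < n
      -- The right side lies beyond the seam and the left side does not. After subtracting `n`, the
      -- right positions fall below `x`, hence before the left ones.
      · refine ⟨x, ?_, ?_, Or.inr fun s hs => ?_⟩
        · simp only [circlePos, hg, if_false] at q2; omega
        · simp only [circlePos, hf, if_true] at q1; omega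
        · have a1 := (hfb s hs).1.2 hf
          have a2 := mt (hgc s hs).1.1 hg
          have := h1 s (hT s hs)
          simp only [circlePos, a1, a2, if_true, if_false]
          omega
      · refine ⟨y - n, ?_, ?_, Or.inl fun s hs => ?_⟩
        · simp only [circlePos, hf, if_false] at q1; omega
        · simp only [circlePos, hg, if_false] at q2; omega
        · have a1 := mt (hfb s hs).1.1 hf
          have a2 := mt (hgc s hs).1.1 hg
          have := h1 s (hT s hs)
          simp only [circlePos, a1, a2, if_false]
          omega
  · exact h.far c b hgt hbn _ hmat.swap

/-- The main geometric argument: matchings confined to one block are controlled by `sync`; all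
others span at least `m`, so an error of a few block lengths is affordable. -/
theorem BlockString.le_of_matching (h : BlockString E n m X) {i x y z r : ℕ} (hi : i < n)
    (hix : i ≤ x) (hxy : x ≤ y) (hyz : y ≤ z) (hz : z ≤ i + n)
    (hmat : HasMatching (fun u => X (circlePos n u)) (fun u => X (circlePos n u)) x y y z r) :
    2 * E * r ≤ z - x := by
  have hm := h.pos
  obtain ⟨f, g, h1, h2⟩ := hmat
  simp only at h1
  rcases Nat.eq_zero_or_pos r with rfl | hr
  · simp
  have h1' : ∀ s < r, (i ≤ f s ∧ f s < y) ∧ (y ≤ g s ∧ g s < i + n) ∧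
      X (circlePos n (f s)) = X (circlePos n (g s)) := fun s hs => by
    have := h1 s hs
    exact ⟨by omega, by omega, this.2.2⟩
  by_cases hall : ∀ s < r, extBlock n m (f s) = extBlock n m (g s)
  · have hsame : ∀ s < r, extBlock n m (f s) = extBlock n m y ∧
        extBlock n m (g s) = extBlock n m y := by
      intro s hs
      have a := h1 s hs
      have b1 := extBlock_mono (n := n) (u := f s) (v := y) hm (by omega)
      have b2 := extBlock_mono (n := n) (u := y) (v := g s) hm (by omega)
      have := hall s hs
      omega
    have hf := fun s hs => extBlock_eq hm (hsame s hs).1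
    have hg := fun s hs => extBlock_eq hm (hsame s hs).2
    have hy2 : y < 2 * n := by have := h1 0 hr; omega
    set b := circlePos n y / m with hb
    have hblk := mem_block (p := circlePos n y) hm
    have hbn : b * m < n := hblk.1.trans_lt (circlePos_lt hy2)
    have c1 := mem_block (p := circlePos n (f 0)) hm
    have c2 := mem_block (p := circlePos n (g (r - 1))) hm
    rw [(hf 0 hr).2] at c1
    rw [(hg (r - 1) (by omega)).2] at c2
    have d0 := (h1 0 hr)
    have d1 := (h1 (r - 1) (by omega))
    have e0 := (hf 0 hr).1
    have e1 := (hg (r - 1) (by omega)).1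
    have hmono : ∀ s < r, f 0 ≤ f s ∧ g s ≤ g (r - 1) := by
      intro s hs
      constructor
      · rcases Nat.eq_zero_or_pos s with rfl | hs0
        · exact le_rfl
        · exact (h2 0 s hs0 hs).1.le
      · rcases Nat.lt_or_ge s (r - 1) with hs1 | hs1
        · exact (h2 s (r - 1) hs1 (by omega)).2.le
        · rw [show s = r - 1 by omega]
    -- The windows are clipped to the span of the matching, since `x` and `z` themselves may lie
    -- outside the block of `y`.
    have hmat' : HasMatching X X (circlePos n (f 0)) (circlePos n y) (circlePos n y)
        (circlePos n (g (r - 1)) + 1) r := by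
      refine ⟨fun s => circlePos n (f s), fun s => circlePos n (g s), ?_, ?_⟩
      · intro s hs
        have a := h1 s hs
        have b1 := (hf s hs).1
        have b2 := (hg s hs).1
        have b3 := hmono s hs
        refine ⟨?_, ?_, a.2.2⟩
        · dsimp only [circlePos]
          split_ifs <;> omega
        · dsimp only [circlePos]
          split_ifs <;> omega
      · intro s t hst ht
        have a := h2 s t hst ht
        have b1 := (hf s (by omega)).1
        have b2 := (hg s (by omega)).1
        have b3 := (hf t ht).1
        have b4 := (hg t ht).1
        dsimp only [circlePos]
        constructor
        · split_ifs <;> omega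
        · split_ifs <;> omega
    have hle := h.sync b hbn _ _ _ _ c1.1 (by unfold circlePos; split_ifs <;> omega)
      (by unfold circlePos; split_ifs <;> omega) (by omega) hmat'
    have hlen : circlePos n (g (r - 1)) + 1 - circlePos n (f 0) ≤ z - x := by
      unfold circlePos; split_ifs <;> omega
    have : 16 * E * r = 8 * (2 * E * r) := by ring
    omega
  · push Not at hall
    obtain ⟨s, hs, hne⟩ := hall
    have hs1 := h1 s hs
    have hge := h.le_sub (u := f s) (v := g s) (by omega) (by omega) (by omega)
      hs1.2.2 hne
    -- Both block indices are nondecreasing along the matching, so their sum determines the pair of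
    -- blocks. The sum takes at most as many values as the window meets blocks.
    set d : ℕ → ℕ := fun s => extBlock n m (f s) + extBlock n m (g s) with hd
    have hcount : ((Finset.range r).image d).card ≤
        extBlock n m (z - 1) - extBlock n m x + 1 := by
      have hsub : (Finset.range r).image d ⊆
          Finset.Icc (extBlock n m x + extBlock n m y)
            (extBlock n m y + extBlock n m (z - 1)) := by
        intro w hw
        simp only [Finset.mem_image, Finset.mem_range] at hw
        obtain ⟨s, hs, rfl⟩ := hw
        have a := h1 s hs
        have b1 := extBlock_mono (n := n) (u := f s) (v := y) hm (by omega)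
        have b2 := extBlock_mono (n := n) (u := y) (v := g s) hm (by omega)
        have b3 := extBlock_mono (n := n) (u := x) (v := f s) hm (by omega)
        have b4 := extBlock_mono (n := n) (u := g s) (v := z - 1) hm (by omega)
        simp only [Finset.mem_Icc, hd]
        omega
      have := Finset.card_le_card hsub
      rw [Nat.card_Icc] at this
      have b5 := extBlock_mono (n := n) (u := x) (v := z - 1) hm (by omega)
      omega
    have hfib : ∀ e ∈ (Finset.range r).image d,
        ((Finset.range r).filter fun s => d s = e).card * (16 * E) ≤ 2 * m := by
      intro e he
      simp only [Finset.mem_image, Finset.mem_range] at he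
      obtain ⟨s0, hs0, rfl⟩ := he
      have hcmp : ∀ s < r, d s = d s0 → extBlock n m (f s) = extBlock n m (f s0) ∧
          extBlock n m (g s) = extBlock n m (g s0) := by
        intro s hs hds
        simp only [hd] at hds
        rcases lt_trichotomy s s0 with hlt | rfl | hlt
        · have a := h2 s s0 hlt hs0
          have b1 := extBlock_mono (n := n) hm a.1.le
          have b2 := extBlock_mono (n := n) hm a.2.le
          omega
        · exact ⟨rfl, rfl⟩
        · have a := h2 s0 s hlt hs
          have b1 := extBlock_mono (n := n) hm a.1.le
          have b2 := extBlock_mono (n := n) hm a.2.le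
          omega
      rw [mul_comm]
      refine h.fiber hi h1' h2 _ (fun s hs => ?_) (extBlock n m (f s0))
        (extBlock n m (g s0)) (fun s hs => ?_) fun s hs => ?_
      · simp only [Finset.mem_filter, Finset.mem_range] at hs
        exact hs.1
      · simp only [Finset.mem_filter, Finset.mem_range] at hs
        exact (hcmp s hs.1 hs.2).1
      · simp only [Finset.mem_filter, Finset.mem_range] at hs
        exact (hcmp s hs.1 hs.2).2
    have hsum : r * (16 * E) ≤ ((Finset.range r).image d).card * (2 * m) := by
      have e1 : r = ∑ e ∈ (Finset.range r).image d,
          ((Finset.range r).filter fun s => d s = e).card := by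
        conv_lhs => rw [← Finset.card_range r]
        exact Finset.card_eq_sum_card_image d (Finset.range r)
      calc r * (16 * E) = ∑ e ∈ (Finset.range r).image d,
            ((Finset.range r).filter fun s => d s = e).card * (16 * E) := by
              rw [← Finset.sum_mul, ← e1]
        _ ≤ ((Finset.range r).image d).card * (2 * m) := by
          rw [← smul_eq_mul]; exact Finset.sum_le_card_nsmul _ _ _ hfib
    have hdist := extBlock_mul_le (n := n) (u := x) (v := z - 1) hm (by omega)
    have hmono := extBlock_mono (n := n) (u := x) (v := z - 1) hm (by omega)
    obtain ⟨Γ, hΓ⟩ := Nat.exists_eq_add_of_le hmono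
    rw [hΓ] at hdist hcount
    rw [Nat.add_mul] at hdist
    rw [Nat.add_sub_cancel_left] at hcount
    -- With `Γ * m ≤ (z - 1 - x) + 2 * m` and `m ≤ z - x`, the right side is at most `2 * (z - x) +
    -- 6 * m ≤ 8 * (z - x)`, which is where the factor `8` between `16 * E` and `2 * E` goes.
    have h3 : r * (16 * E) ≤ (Γ + 1) * (2 * m) := hsum.trans (Nat.mul_le_mul_right _ hcount)
    have h4 : (Γ + 1) * (2 * m) = 2 * (Γ * m) + 2 * m := by ring
    have h5 : r * (16 * E) = 8 * (2 * E * r) := by ring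
    omega

end Circle

/-! ### From matchings to edit distance -/

section Strings

variable {α : Type*}

/-- The symbols that survive all edits form a common subsequence. A deletion either removes a symbol
outside it, or shortens it by one, and both keep the length balance. -/
theorem Edits.exists_common {t : ℕ} {S S' : List α} (h : Edits t S S') :
    ∃ c : List α, c.Sublist S ∧ c.Sublist S' ∧ S.length + S'.length ≤ t + 2 * c.length := by
  induction h with
  | refl S => exact ⟨S, List.Sublist.refl _, List.Sublist.refl _, by omega⟩
  | insert u a v _ ih =>
    obtain ⟨c, h1, h2, h3⟩ := ih
    refine ⟨c, h1, h2.trans (List.Sublist.append_left (List.sublist_cons_self a v) u), ?_⟩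
    simp only [List.length_append, List.length_cons] at h3 ⊢
    omega
  | delete u a v _ ih =>
    obtain ⟨c, h1, h2, h3⟩ := ih
    simp only [List.length_append, List.length_cons] at h3
    obtain ⟨c1, c2, rfl, hc1, hc2⟩ := List.sublist_append_iff.1 h2
    rcases List.sublist_cons_iff.1 hc2 with hc | ⟨c3, rfl, hc3⟩
    · refine ⟨c1 ++ c2, h1, hc1.append hc, ?_⟩
      simp only [List.length_append] at h3 ⊢
      omega
    · refine ⟨c1 ++ c3, ?_, hc1.append hc3, ?_⟩
      · exact (List.Sublist.append_left (List.sublist_cons_self a c3) c1).trans h1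
      · simp only [List.length_append, List.length_cons] at h3 ⊢
        omega

theorem edits_editDist (S S' : List α) : Edits (editDist S S') S S' :=
  Nat.sInf_mem (exists_edits S S')

theorem length_substr {T : List α} {i j : ℕ} (hj : j ≤ T.length) :
    (substr T i j).length = j - (i - 1) := by
  simp [substr, Nat.min_eq_left hj]

theorem getElem?_substr {T : List α} {i j p : ℕ} {a : α} (h : (substr T i j)[p]? = some a) :
    i - 1 + p < j ∧ T[i - 1 + p]? = some a := by
  rw [substr, List.getElem?_drop, List.getElem?_take] at h
  split_ifs at h with hlt
  exact ⟨hlt, h⟩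

theorem isSyncString_of_matching {T : List α} (code : α → ℕ) {R : ℕ → ℕ} {ε : ℝ} {E : ℕ}
    (hE : 2 ≤ E) (hε : 1 / (E : ℝ) ≤ ε) (hR : ∀ p a, T[p]? = some a → R p = code a)
    (h : ∀ x y z r, x ≤ y → y ≤ z → z ≤ T.length → HasMatching R R x y y z r →
      2 * E * r ≤ z - x) : IsSyncString ε T := by
  intro i j k hi hij hjk hk
  obtain ⟨c, hc1, hc2, hlen⟩ := (edits_editDist (substr T i j) (substr T (j + 1) k)).exists_common
  rw [length_substr (by omega), length_substr hk] at hlen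
  obtain ⟨f, hf⟩ := List.sublist_iff_exists_orderEmbedding_getElem?_eq.1 hc1
  obtain ⟨g, hg⟩ := List.sublist_iff_exists_orderEmbedding_getElem?_eq.1 hc2
  have hm := h (i - 1) j k c.length (by omega) (by omega) hk
    ⟨fun s => i - 1 + f s, fun s => j + g s, fun s hs => by
      have h1 := getElem?_substr ((hf s).symm.trans (List.getElem?_eq_getElem hs))
      have h2 := getElem?_substr ((hg s).symm.trans (List.getElem?_eq_getElem hs))
      simp only [Nat.add_sub_cancel] at h2
      exact ⟨⟨Nat.le_add_right _ _, h1.1⟩, ⟨Nat.le_add_right _ _, h2.1⟩, (hR _ _ h1.2).trans (hR _ _ h2.2).symm⟩,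
    fun s t hst _ => ⟨Nat.add_lt_add_left (f.strictMono hst) _,
      Nat.add_lt_add_left (g.strictMono hst) _⟩⟩
  have h3 : k - i + 1 ≤ editDist (substr T i j) (substr T (j + 1) k) + 2 * c.length := by omega
  have h4 : 2 * E * c.length ≤ k - i + 1 := by omega
  obtain ⟨d, rfl⟩ := Nat.exists_eq_add_of_lt (hij.trans hjk)
  rw [show i + d + 1 - i + 1 = d + 2 by omega] at h3 h4
  set e := editDist (substr T i j) (substr T (j + 1) (i + d + 1))
  have h3' : (d : ℝ) + 2 ≤ e + 2 * c.length := by exact_mod_cast h3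
  have h4' : 2 * (E : ℝ) * c.length ≤ d + 2 := by exact_mod_cast h4
  have hE' : (2 : ℝ) ≤ E := by exact_mod_cast hE
  have h5 : 2 * (c.length : ℝ) ≤ (d + 2) * (1 / E) := by
    rw [mul_one_div, le_div_iff₀ (by linarith)]
    linarith
  -- The windows have total length `k - i + 1`, one more than the `k - i` in the definition. As `1 -
  -- 1 / E` is positive, this extra symbol supplies the strict inequality.
  have h6 : 1 / (E : ℝ) ≤ 1 / 2 := one_div_le_one_div_of_le (by norm_num) hE'
  have hd : (0 : ℝ) ≤ d := Nat.cast_nonneg d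
  push_cast
  nlinarith [mul_le_mul_of_nonneg_right hε (by linarith : (0 : ℝ) ≤ d + 1)]

theorem isSyncCircle_of_matching {S : List α} (code : α → ℕ) {X : ℕ → ℕ} {ε : ℝ} {E : ℕ}
    (hE : 2 ≤ E) (hε : 1 / (E : ℝ) ≤ ε) (hX : ∀ p a, S[p]? = some a → X p = code a)
    (h : ∀ i x y z r, i < S.length → i ≤ x → x ≤ y → y ≤ z → z ≤ i + S.length →
      HasMatching (fun u => X (u % S.length)) (fun u => X (u % S.length)) x y y z r →
      2 * E * r ≤ z - x) : IsSyncCircle ε S := by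
  intro i hi hin
  refine isSyncString_of_matching code (R := fun p => X ((p + (i - 1)) % S.length)) hE hε ?_ ?_
  · intro p a hp
    have hlt : p < S.length := by
      have := (List.getElem?_eq_some_iff.1 hp).1
      rwa [List.length_rotate] at this
    rw [List.getElem?_rotate hlt] at hp
    exact hX _ _ hp
  · intro x y z r hxy hyz hz hm
    rw [List.length_rotate] at hz
    obtain ⟨f, g, h1, h2⟩ := hm
    have := h (i - 1) (x + (i - 1)) (y + (i - 1)) (z + (i - 1)) r (by omega) (by omega) (by omega)
      (by omega) (by omega) ⟨fun s => f s + (i - 1), fun s => g s + (i - 1), fun s hs => by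
        have := h1 s hs
        exact ⟨by dsimp only; omega, by dsimp only; omega, this.2.2⟩, fun s t hst ht => by
        have := h2 s t hst ht
        exact ⟨by dsimp only; omega, by dsimp only; omega⟩⟩
    omega

end Strings

/-- The first `n` cells of an array with entries below `q`, as a string over `Fin q`. -/
theorem exists_string {q n : ℕ} {X : ℕ → ℕ} (hX : ∀ p < n, X p < q) :
    ∃ S : List (Fin q), S.length = n ∧ (List.range n).map X = S.map Fin.val ∧
      ∀ p a, S[p]? = some a → X p = Fin.val a := by
  refine ⟨List.ofFn fun p : Fin n => ⟨X p, hX p p.2⟩, by simp, ?_, ?_⟩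
  · rw [List.map_ofFn]
    apply List.ext_getElem <;> simp
  · intro p a hp
    rw [List.getElem?_ofFn] at hp
    split_ifs at hp
    simp only [Option.some.injEq] at hp
    rw [← hp]

/-- A window of length at most `n` visits no position of the circle twice, so with distinct symbols
nothing can be matched. -/
theorem exists_circle_of_injective {n E : ℕ} {ε : ℝ} {X : ℕ → ℕ} (hE : 2 ≤ E)
    (hε : 1 / (E : ℝ) ≤ ε) (hX : ∀ p < n, X p = p) :
    ∃ S : List (Fin n), S.length = n ∧ (List.range n).map X = S.map Fin.val ∧ IsSyncCircle ε S := by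
  obtain ⟨S, hS, hmap, hval⟩ := exists_string (q := n) (n := n) (X := X)
    fun p hp => by rw [hX p hp]; exact hp
  refine ⟨S, hS, hmap, isSyncCircle_of_matching Fin.val hE hε hval ?_⟩
  rw [hS]
  intro i x y z r hi hix hxy hyz hz hm
  obtain ⟨f, g, h1, h2⟩ := hm
  rcases Nat.eq_zero_or_pos r with rfl | hr
  · simp
  · exfalso
    have := h1 0 hr
    simp only at this
    rw [hX _ (Nat.mod_lt _ (by omega)), hX _ (Nat.mod_lt _ (by omega)),
      ← circlePos_eq_mod (by omega), ← circlePos_eq_mod (by omega)] at this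
    unfold circlePos at this
    split_ifs at this <;> omega

theorem BlockString.exists_circle {q n m E : ℕ} {ε : ℝ} {X : ℕ → ℕ} (h : BlockString E n m X)
    (hE : 2 ≤ E) (hε : 1 / (E : ℝ) ≤ ε) (hX : ∀ p < n, X p < q) :
    ∃ S : List (Fin q), S.length = n ∧ (List.range n).map X = S.map Fin.val ∧ IsSyncCircle ε S := by
  obtain ⟨S, hS, hmap, hval⟩ := exists_string hX
  refine ⟨S, hS, hmap, isSyncCircle_of_matching Fin.val hE hε hval ?_⟩
  rw [hS]
  intro i x y z r hi hix hxy hyz hz hm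
  refine h.le_of_matching hi hix hxy hyz hz (hm.congr ?_ ?_)
  · intro p _ hp
    rw [circlePos_eq_mod (by omega)]
  · intro p _ hp
    rw [circlePos_eq_mod (by omega)]

/-! ### Program logic with running times -/

/-- `Halts P T Q s`: started in `s`, the program `P` halts after at most `T` steps in a state
satisfying `Q`. -/
def Halts (P : Prog) (T : ℕ) (Q : State → Prop) (s : State) : Prop :=
  ∃ t s', Run P s t s' ∧ t ≤ T ∧ Q s'

theorem Halts.mono {P : Prog} {T T' : ℕ} {Q : State → Prop} {s : State} (h : Halts P T Q s)
    (hT : T ≤ T') : Halts P T' Q s :=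
  let ⟨t, s', h1, h2, h3⟩ := h
  ⟨t, s', h1, h2.trans hT, h3⟩

theorem Halts.imp {P : Prog} {T : ℕ} {Q Q' : State → Prop} {s : State} (h : Halts P T Q s)
    (hQ : ∀ s', Q s' → Q' s') : Halts P T Q' s :=
  let ⟨t, s', h1, h2, h3⟩ := h
  ⟨t, s', h1, h2, hQ s' h3⟩

/-- The registers written by an instruction. -/
def Instr.regs : Instr → List ℕ
  | .const i _ => [i]
  | .add i _ _ => [i]
  | .sub i _ _ => [i]
  | .load i _ _ => [i]
  | .store _ _ _ => []

/-- The arrays written by an instruction. -/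
def Instr.arrs : Instr → List ℕ
  | .store a _ _ => [a]
  | _ => []

/-- The registers that occur as targets in a program. -/
def Prog.regs : Prog → List ℕ
  | .skip => []
  | .basic I => I.regs
  | .seq P Q => P.regs ++ Q.regs
  | .branch _ P Q => P.regs ++ Q.regs
  | .loop _ P => P.regs

/-- The arrays that occur as targets in a program. -/
def Prog.arrs : Prog → List ℕ
  | .skip => []
  | .basic I => I.arrs
  | .seq P Q => P.arrs ++ Q.arrs
  | .branch _ P Q => P.arrs ++ Q.arrs
  | .loop _ P => P.arrs

section Exec

variable (s : State) (i j k c a r b x : ℕ)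

@[simp] theorem exec_const_reg :
    ((Instr.const i c).exec s).reg r = if r = i then c else s.reg r := by
  simp [Instr.exec, Function.update_apply]

@[simp] theorem exec_const_arr : ((Instr.const i c).exec s).arr = s.arr := rfl

@[simp] theorem exec_add_reg :
    ((Instr.add i j k).exec s).reg r = if r = i then s.reg j + s.reg k else s.reg r := by
  simp [Instr.exec, Function.update_apply]

@[simp] theorem exec_add_arr : ((Instr.add i j k).exec s).arr = s.arr := rfl

@[simp] theorem exec_sub_reg :
    ((Instr.sub i j k).exec s).reg r = if r = i then s.reg j - s.reg k else s.reg r := by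
  simp [Instr.exec, Function.update_apply]

@[simp] theorem exec_sub_arr : ((Instr.sub i j k).exec s).arr = s.arr := rfl

@[simp] theorem exec_load_reg :
    ((Instr.load i a j).exec s).reg r = if r = i then s.arr a (s.reg j) else s.reg r := by
  simp [Instr.exec, Function.update_apply]

@[simp] theorem exec_load_arr : ((Instr.load i a j).exec s).arr = s.arr := rfl

@[simp] theorem exec_store_reg : ((Instr.store a i j).exec s).reg = s.reg := rfl

@[simp] theorem exec_store_arr : ((Instr.store a i j).exec s).arr b x =
    if b = a ∧ x = s.reg i then s.reg j else s.arr b x := by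
  by_cases h : b = a
  · subst h
    simp [Instr.exec, Function.update_apply]
  · simp [Instr.exec, h]

end Exec

/-- `s'` agrees with `s` on everything that `P` does not write. -/
structure Frame (P : Prog) (s s' : State) : Prop where
  reg : ∀ r, r ∉ P.regs → s'.reg r = s.reg r
  arr : ∀ a, a ∉ P.arrs → s'.arr a = s.arr a

theorem Frame.refl (P : Prog) (s : State) : Frame P s s := ⟨fun _ _ => rfl, fun _ _ => rfl⟩

theorem Frame.trans {P : Prog} {s s' s'' : State} (h : Frame P s s') (h' : Frame P s' s'') :
    Frame P s s'' :=
  ⟨fun r hr => (h'.reg r hr).trans (h.reg r hr), fun a ha => (h'.arr a ha).trans (h.arr a ha)⟩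

theorem Frame.weaken {P Q : Prog} {s s' : State} (h : Frame P s s')
    (hr : ∀ r ∈ P.regs, r ∈ Q.regs) (ha : ∀ a ∈ P.arrs, a ∈ Q.arrs) : Frame Q s s' :=
  ⟨fun r hr' => h.reg r (mt (hr r) hr'), fun a ha' => h.arr a (mt (ha a) ha')⟩

theorem frame_exec (I : Instr) (s : State) : Frame (.basic I) s (I.exec s) := by
  constructor
  · intro r hr
    cases I <;> simp_all [Prog.regs, Instr.regs]
  · intro b hb
    cases I <;> simp_all [Prog.arrs, Instr.arrs]
    funext x
    simp [hb]

theorem Run.frame {P : Prog} {s s' : State} {t : ℕ} (h : Run P s t s') : Frame P s s' := by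
  induction h with
  | skip => exact Frame.refl _ _
  | basic I s => exact frame_exec I s
  | seq _ _ ih₁ ih₂ =>
    exact (ih₁.weaken (by simp +contextual [Prog.regs]) (by simp +contextual [Prog.arrs])).trans
      (ih₂.weaken (by simp +contextual [Prog.regs]) (by simp +contextual [Prog.arrs]))
  | branch_true _ _ ih =>
    exact ih.weaken (by simp +contextual [Prog.regs]) (by simp +contextual [Prog.arrs])
  | branch_false _ _ ih =>
    exact ih.weaken (by simp +contextual [Prog.regs]) (by simp +contextual [Prog.arrs])
  | loop_done => exact Frame.refl _ _
  | loop_step _ _ _ ih₁ ih₂ =>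
    exact Frame.trans (P := .loop _ _) (ih₁.weaken (fun _ => id) fun _ => id) ih₂

/-- Sequential composition of a list of programs. -/
def seqs : List Prog → Prog
  | [] => .skip
  | P :: Ps => .seq P (seqs Ps)

theorem halts_nil {Q : State → Prop} {s : State} (h : Q s) : Halts (seqs []) 1 Q s :=
  ⟨1, s, .skip s, le_rfl, h⟩

theorem halts_basic {I : Instr} {Ps : List Prog} {T : ℕ} {Q : State → Prop} {s : State}
    (h : Halts (seqs Ps) T Q (I.exec s)) : Halts (seqs (.basic I :: Ps)) (T + 1) Q s :=
  let ⟨t, s', h1, h2, h3⟩ := h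
  ⟨1 + t, s', .seq (.basic I s) h1, by omega, h3⟩

theorem halts_cons {P : Prog} {Ps : List Prog} {T₁ T₂ : ℕ} {R Q : State → Prop} {s : State}
    (h₁ : Halts P T₁ R s) (h₂ : ∀ s₁, R s₁ → Frame P s s₁ → Halts (seqs Ps) T₂ Q s₁) :
    Halts (seqs (P :: Ps)) (T₁ + T₂) Q s :=
  let ⟨t₁, s₁, a1, a2, a3⟩ := h₁
  let ⟨t₂, s₂, b1, b2, b3⟩ := h₂ s₁ a3 a1.frame
  ⟨t₁ + t₂, s₂, .seq a1 b1, by omega, b3⟩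

theorem halts_branch {i : ℕ} {P P' : Prog} {T : ℕ} {Q : State → Prop} {s : State}
    (h₁ : s.reg i ≠ 0 → Halts P T Q s) (h₂ : s.reg i = 0 → Halts P' T Q s) :
    Halts (.branch i P P') (T + 1) Q s := by
  by_cases hi : s.reg i = 0
  · obtain ⟨t, s', a1, a2, a3⟩ := h₂ hi
    exact ⟨t + 1, s', .branch_false hi a1, by omega, a3⟩
  · obtain ⟨t, s', a1, a2, a3⟩ := h₁ hi
    exact ⟨t + 1, s', .branch_true hi a1, by omega, a3⟩

/-- The index of the invariant is a potential that every iteration lowers, so `N` bounds their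
number. The loop may stop before the potential reaches `0`. -/
theorem halts_loop {i : ℕ} {P : Prog} {T : ℕ} (Inv : ℕ → State → Prop) (N : ℕ) {s₀ : State}
    (h0 : Inv N s₀)
    (step : ∀ k s, Inv k s → s.reg i ≠ 0 → Frame P s₀ s →
      Halts P T (fun s' => ∃ k' < k, Inv k' s') s) :
    Halts (.loop i P) (N * (T + 1) + 1) (fun s' => s'.reg i = 0 ∧ ∃ k, Inv k s') s₀ := by
  suffices ∀ N s, Inv N s → Frame P s₀ s →
      Halts (.loop i P) (N * (T + 1) + 1) (fun s' => s'.reg i = 0 ∧ ∃ k, Inv k s') s from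
    this N s₀ h0 (Frame.refl _ _)
  intro N
  induction N using Nat.strong_induction_on with
  | _ N ih =>
    intro s hs hfr
    by_cases hi : s.reg i = 0
    · exact ⟨1, s, .loop_done hi, by omega, hi, N, hs⟩
    · obtain ⟨t₁, s₁, a1, a2, k', hk', a3⟩ := step N s hs hi hfr
      obtain ⟨t₂, s₂, b1, b2, b3⟩ := ih k' hk' s₁ a3 (hfr.trans a1.frame)
      refine ⟨t₁ + t₂ + 1, s₂, .loop_step hi a1 b1, ?_, b3⟩
      have : (k' + 1) * (T + 1) ≤ N * (T + 1) := Nat.mul_le_mul_right _ hk'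
      rw [Nat.add_mul] at this
      omega

/-- Repeat `body`, counting register `c` down to `0` by means of register `3`, which holds `1`. -/
def forLoop (c : ℕ) (body : Prog) : Prog := .loop c (seqs [body, .basic (.sub c c 3)])

theorem halts_for {c : ℕ} {body : Prog} {T N : ℕ} (Inv : ℕ → State → Prop) {s₀ : State}
    (hN : s₀.reg c = N) (h3 : s₀.reg 3 = 1) (hc : c ∉ body.regs) (hb : 3 ∉ body.regs) (hc3 : c ≠ 3)
    (h0 : Inv 0 s₀)
    (step : ∀ k s, k < N → Inv k s → Frame (forLoop c body) s₀ s →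
      Halts body T (fun s' => Inv (k + 1) ((Instr.sub c c 3).exec s')) s) :
    Halts (forLoop c body) (N * (T + 3) + 1) (Inv N) s₀ := by
  have key := halts_loop (i := c) (P := seqs [body, .basic (.sub c c 3)]) (T := T + 2)
    (fun k s => k ≤ N ∧ s.reg c = k ∧ Inv (N - k) s) N (s₀ := s₀)
    ⟨le_rfl, hN, by simpa using h0⟩ ?_
  · refine Halts.imp key ?_
    rintro s' ⟨hz, k, _, hk, hInv⟩
    obtain rfl : k = 0 := by omega
    simpa using hInv
  · rintro k s ⟨hkN, hk, hInv⟩ hne hfr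
    have h3s : s.reg 3 = 1 := by
      rw [hfr.reg 3 (by simp [seqs, Prog.regs, Instr.regs, hb, hc3.symm]), h3]
    refine halts_cons (step (N - k) s (by omega) hInv
      (hfr.weaken (fun _ => id) fun _ => id)) fun s₁ h1 hf1 => ?_
    refine halts_basic (halts_nil ⟨k - 1, by omega, by omega, ?_, ?_⟩)
    · simp [hf1.reg c hc, hf1.reg 3 hb, hk, h3s]
    · rwa [show N - (k - 1) = N - k + 1 by omega]

/-- `R_i := c` -/
abbrev con (i c : ℕ) : Prog := .basic (.const i c)
/-- `R_i := R_j + R_k` -/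
abbrev add (i j k : ℕ) : Prog := .basic (.add i j k)
/-- `R_i := R_j - R_k` -/
abbrev sub (i j k : ℕ) : Prog := .basic (.sub i j k)
/-- `R_i := A_a[R_j]` -/
abbrev load (i a j : ℕ) : Prog := .basic (.load i a j)
/-- `A_a[R_i] := R_j` -/
abbrev store (a i j : ℕ) : Prog := .basic (.store a i j)
/-- `R_i := R_j`; register `40` holds `0` -/
abbrev copy (i j : ℕ) : Prog := .basic (.add i j 40)

/-! ### The dynamic program for common subsequences -/

/-- One cell of the dynamic program for `F * lcs`. -/
def lcsCell : Prog := seqs [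
  add 29 27 3, load 30 1 29, load 32 0 27, sub 33 23 32, sub 34 32 23, add 33 33 34,
  .branch 33 (seqs [load 31 1 27, sub 34 30 31, add 31 31 34]) (seqs [add 31 26 5]),
  store 1 29 31, copy 26 30, copy 27 29]

/-- One row of the dynamic program. -/
def lcsRow : Prog := seqs [
  load 23 0 24, con 26 0, copy 27 20, copy 28 35, forLoop 28 lcsCell, add 24 24 3]

/-- Adds to register `13` the excess of `F` times the length of a longest common subsequence of
`A_0[R_18, R_19)` and `A_0[R_20, R_21)` over the total length of the two windows. -/
def lcsCheck : Prog := seqs [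
  sub 35 21 20, add 25 35 3, copy 24 20,
  forLoop 25 (seqs [store 1 24 40, add 24 24 3]),
  sub 25 19 18, copy 24 18, forLoop 25 lcsRow,
  add 29 20 35, load 30 1 29, sub 31 19 18, add 31 31 35, sub 30 30 31, add 13 13 30]

/-- A single array holds the new row up to column `y` and the old row after it; register `26` keeps
the overwritten diagonal entry. Entries are stored multiplied by `F`, so the final comparison needs
no multiplication. -/
theorem halts_lcsCell {s : State} {F t i l x y : ℕ} {X : ℕ → ℕ} (h3 : s.reg 3 = 1)
    (h40 : s.reg 40 = 0) (h5 : s.reg 5 = F) (hX : s.arr 0 = X) (h23 : s.reg 23 = X (i + x))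
    (h27 : s.reg 27 = l + y) (h26 : s.reg 26 = F * lcs X X i l x y) (hy : y < t)
    (hrow : ∀ z ≤ t, s.arr 1 (l + z) =
      F * if z ≤ y then lcs X X i l (x + 1) z else lcs X X i l x z) :
    Halts lcsCell 20 (fun s' => s'.reg 27 = l + (y + 1) ∧
      s'.reg 26 = F * lcs X X i l x (y + 1) ∧ ∀ z ≤ t, s'.arr 1 (l + z) =
      F * if z ≤ y + 1 then lcs X X i l (x + 1) z else lcs X X i l x z) s := by
  apply Halts.mono
  · unfold lcsCell
    iterate 6 apply halts_basic
    apply halts_cons (R := fun s' => s'.reg 31 = F * lcs X X i l (x + 1) (y + 1)) (T₁ := 5)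
    · have hup := hrow (y + 1) hy
      have hleft := hrow y hy.le
      rw [if_neg (by omega), ← Nat.add_assoc] at hup
      rw [if_pos le_rfl] at hleft
      refine halts_branch (T := 4) ?_ ?_
      · intro hne
        have hne' : X (i + x) ≠ X (l + y) := by
          intro h
          simp [h23, h27, hX, h] at hne
        iterate 3 apply halts_basic
        apply halts_nil
        simp only [exec_add_reg, exec_sub_reg, exec_load_reg, exec_load_arr, exec_add_arr,
          exec_sub_arr]
        simp only [Nat.reduceEqDiff, if_true, if_false, h27, h3, hup, hleft, lcs, hne']
        -- The program forms the maximum as `v + (u - v)` with truncated subtraction.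
        rw [← Nat.mul_max_mul_left]
        omega
      · intro heq
        have heq' : X (i + x) = X (l + y) := by
          simp [h23, h27, hX] at heq
          omega
        refine Halts.mono (T := 2) ?_ (by omega)
        apply halts_basic
        apply halts_nil
        simp [h26, h5, lcs, heq', Nat.mul_add]
    · intro s₁ h31 hfr
      iterate 3 apply halts_basic
      apply halts_nil
      have e29 := hfr.reg 29 (by decide)
      have e30 := hfr.reg 30 (by decide)
      have e40 := hfr.reg 40 (by decide)
      have ea := hfr.arr 1 (by decide)
      have hup := hrow (y + 1) hy
      rw [if_neg (by omega), ← Nat.add_assoc] at hup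
      simp [h27, h3, h40, hup] at e29 e30 e40 ea
      simp [e29, e30, e40, h31, ea]
      refine ⟨by omega, fun z hz => ?_⟩
      have := hrow z hz
      by_cases hzy : z = y + 1
      · subst hzy
        simp [Nat.add_assoc]
      · rw [if_neg (by omega), this]
        by_cases hzy' : z ≤ y
        · rw [if_pos hzy', if_pos (by omega)]
        · rw [if_neg hzy', if_neg (by omega)]
  · norm_num

theorem halts_lcsRow {s : State} {F t i l x : ℕ} {X : ℕ → ℕ} (h3 : s.reg 3 = 1)
    (h40 : s.reg 40 = 0) (h5 : s.reg 5 = F) (hX : s.arr 0 = X) (h20 : s.reg 20 = l)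
    (h24 : s.reg 24 = i + x) (h35 : s.reg 35 = t)
    (hrow : ∀ z ≤ t, s.arr 1 (l + z) = F * lcs X X i l x z) :
    Halts lcsRow (30 * (t + 1)) (fun s' => s'.reg 24 = i + (x + 1) ∧
      ∀ z ≤ t, s'.arr 1 (l + z) = F * lcs X X i l (x + 1) z) s := by
  apply Halts.mono
  · unfold lcsRow
    iterate 4 apply halts_basic
    apply halts_cons
    · refine halts_for (N := t) (T := 20) (fun y s' => s'.reg 27 = l + y ∧
        s'.reg 26 = F * lcs X X i l x y ∧ ∀ z ≤ t, s'.arr 1 (l + z) =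
        F * if z ≤ y then lcs X X i l (x + 1) z else lcs X X i l x z)
        ?_ ?_ (by decide) (by decide) (by decide) ?_ ?_
      · simp [h35, h40]
      · simp [h3]
      · simp only [exec_add_reg, exec_add_arr, exec_const_reg, exec_load_arr, exec_const_arr,
          exec_load_reg]
        simp only [h20, h40, lcs_zero_right, Nat.reduceEqDiff, if_true, if_false]
        refine ⟨by simp, by simp, fun z hz => ?_⟩
        rw [hrow z hz]
        rcases Nat.eq_zero_or_pos z with rfl | hz0
        · simp
        · rw [if_neg (by omega)]
      · rintro y s' hy ⟨h27, h26, hr⟩ hfr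
        have e3 := hfr.reg 3 (by decide)
        have e40 := hfr.reg 40 (by decide)
        have e5 := hfr.reg 5 (by decide)
        have e23 := hfr.reg 23 (by decide)
        have ea := hfr.arr 0 (by decide)
        simp [h3, h40, h5, h24, hX] at e3 e40 e5 e23 ea
        refine (halts_lcsCell e3 e40 e5 ea e23 h27 h26 hy hr).imp fun s'' hs => ?_
        simpa using hs
    · rintro s₁ ⟨-, -, hr⟩ hfr
      apply halts_basic
      apply halts_nil
      have e3 := hfr.reg 3 (by decide)
      have e24 := hfr.reg 24 (by decide)
      simp [h3, h24] at e3 e24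
      refine ⟨by simp [e3, e24, Nat.add_assoc], fun z hz => ?_⟩
      simp only [exec_add_arr]
      rw [hr z hz, if_pos hz]
  · omega

/-- The condition tested by `lcsCheck`. -/
def LcsLe (F : ℕ) (X : ℕ → ℕ) (i j l k : ℕ) : Prop :=
  F * lcs X X i l (j - i) (k - l) ≤ (j - i) + (k - l)

theorem lcsLe_iff {F : ℕ} {X : ℕ → ℕ} {i j l k : ℕ} :
    LcsLe F X i j l k ↔ ∀ r, HasMatching X X i j l k r → F * r ≤ (j - i) + (k - l) := by
  constructor
  · intro h r hr
    have h1 := hr.le_left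
    have h2 := hr.swap.le_left
    rcases Nat.eq_zero_or_pos r with rfl | hr0
    · simp
    · refine le_trans (Nat.mul_le_mul_left F ?_) h
      refine HasMatching.le_lcs (hr.mono le_rfl ?_ le_rfl ?_ le_rfl) <;> omega
  · intro h
    rcases Nat.lt_or_ge i j with hij | hij
    · rcases Nat.lt_or_ge l k with hlk | hlk
      · have := hasMatching_lcs X X i l (j - i) (k - l)
        rw [Nat.add_sub_cancel' hij.le, Nat.add_sub_cancel' hlk.le] at this
        exact h _ this
      · simp [LcsLe, Nat.sub_eq_zero_of_le hlk]
    · simp [LcsLe, Nat.sub_eq_zero_of_le hij]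

theorem halts_lcsCheck {s : State} {F i j l k M : ℕ} {X : ℕ → ℕ} (h3 : s.reg 3 = 1)
    (h40 : s.reg 40 = 0) (h5 : s.reg 5 = F) (hX : s.arr 0 = X) (h18 : s.reg 18 = i)
    (h19 : s.reg 19 = j) (h20 : s.reg 20 = l) (h21 : s.reg 21 = k)
    (hij : j - i + 1 ≤ M) (hlk : k - l + 1 ≤ M) :
    Halts lcsCheck (60 * M ^ 2) (fun s' => s'.reg 13 = 0 ↔
      s.reg 13 = 0 ∧ LcsLe F X i j l k) s := by
  apply Halts.mono
  · unfold lcsCheck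
    iterate 3 apply halts_basic
    apply halts_cons
    · refine halts_for (N := k - l + 1) (T := 3) (fun y s' => s'.reg 24 = l + y ∧
        ∀ z < y, s'.arr 1 (l + z) = 0) ?_ ?_ (by decide) (by decide) (by decide) ?_ ?_
      · simp [h20, h21, h3]
      · simp [h3]
      · simp [h20, h40]
      · rintro y s' hy ⟨h24, hr⟩ hfr
        have e3 := hfr.reg 3 (by decide)
        have e40 := hfr.reg 40 (by decide)
        simp [h3, h40] at e3 e40
        iterate 2 apply halts_basic
        apply halts_nil
        simp [h24, e3, e40, Nat.add_assoc]
        intro z hz hne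
        exact hr z (by omega)
    rintro s₁ ⟨h24, hr⟩ hfr₁
    have e3 := hfr₁.reg 3 (by decide)
    have e40 := hfr₁.reg 40 (by decide)
    have e5 := hfr₁.reg 5 (by decide)
    have e13 := hfr₁.reg 13 (by decide)
    have e18 := hfr₁.reg 18 (by decide)
    have e19 := hfr₁.reg 19 (by decide)
    have e20 := hfr₁.reg 20 (by decide)
    have e35 := hfr₁.reg 35 (by decide)
    have ea := hfr₁.arr 0 (by decide)
    simp [h3, h40, h5, h18, h19, h20, h21, hX] at e3 e40 e5 e13 e18 e19 e20 e35 ea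
    iterate 2 apply halts_basic
    apply halts_cons
    · refine halts_for (N := j - i) (T := 30 * (k - l + 1)) (fun x s' => s'.reg 24 = i + x ∧
        ∀ z ≤ k - l, s'.arr 1 (l + z) = F * lcs X X i l x z)
        ?_ ?_ (by decide) (by decide) (by decide) ?_ ?_
      · simp [e18, e19]
      · simp [e3]
      · simp [e18, e40]
        exact fun z hz => hr z (by omega)
      · rintro x s' hx ⟨h24, hr⟩ hfr
        have f3 := hfr.reg 3 (by decide)
        have f40 := hfr.reg 40 (by decide)
        have f5 := hfr.reg 5 (by decide)
        have f20 := hfr.reg 20 (by decide)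
        have f35 := hfr.reg 35 (by decide)
        have fa := hfr.arr 0 (by decide)
        simp [e3, e40, e5, e20, e35, ea] at f3 f40 f5 f20 f35 fa
        refine (halts_lcsRow f3 f40 f5 fa f20 h24 f35 hr).imp fun s'' hs => ?_
        simpa using hs
    rintro s₂ ⟨-, hr₂⟩ hfr₂
    have f3 := hfr₂.reg 3 (by decide)
    have f13 := hfr₂.reg 13 (by decide)
    have f18 := hfr₂.reg 18 (by decide)
    have f19 := hfr₂.reg 19 (by decide)
    have f20 := hfr₂.reg 20 (by decide)
    have f35 := hfr₂.reg 35 (by decide)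
    simp [e3, e13, e18, e19, e20, e35] at f3 f13 f18 f19 f20 f35
    iterate 6 apply halts_basic
    apply halts_nil
    simp [f13, f18, f19, f20, f35, hr₂, LcsLe, Nat.sub_eq_zero_iff_le]
  · have h1 : (j - i) * (30 * (k - l + 1) + 3) ≤ M * (30 * M + 3) := by
      apply Nat.mul_le_mul <;> omega
    have h2 : M * (30 * M + 3) = 30 * M ^ 2 + 3 * M := by ring
    have h3 : M ≤ M ^ 2 := Nat.le_self_pow (by omega) M
    omega

/-! ### Testing a candidate block -/

/-- The registers that hold constants throughout the main phase. -/
structure Consts (F q m : ℕ) (s : State) : Prop where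
  one : s.reg 3 = 1
  zero : s.reg 40 = 0
  F : s.reg 5 = F
  q : s.reg 6 = q
  m : s.reg 8 = m

theorem Consts.frame {F q m : ℕ} {P : Prog} {s s' : State} (h : Consts F q m s)
    (hfr : Frame P s s') (hP : ∀ r ∈ [3, 40, 5, 6, 8], r ∉ P.regs) : Consts F q m s' :=
  ⟨by rw [hfr.reg 3 (hP 3 (by simp)), h.one], by rw [hfr.reg 40 (hP 40 (by simp)), h.zero],
    by rw [hfr.reg 5 (hP 5 (by simp)), h.F], by rw [hfr.reg 6 (hP 6 (by simp)), h.q],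
    by rw [hfr.reg 8 (hP 8 (by simp)), h.m]⟩

theorem Consts.exec {F q m : ℕ} {I : Instr} {s : State} (h : Consts F q m s)
    (hI : ∀ r ∈ [3, 40, 5, 6, 8], r ∉ I.regs) : Consts F q m (I.exec s) :=
  h.frame (frame_exec I s) hI

theorem and_forall_lt_succ {A : Prop} {p : ℕ → Prop} {j : ℕ} :
    ((A ∧ ∀ x < j, p x) ∧ p j) ↔ A ∧ ∀ x < j + 1, p x := by
  rw [Nat.forall_lt_succ_right, and_assoc]

/-- Innermost loop of `checkSync`. -/
def checkSyncRight : Prog := seqs [copy 20 19, copy 21 9, add 38 8 3,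
  forLoop 38 (seqs [lcsCheck, add 21 21 3])]

/-- Middle loop of `checkSync`. -/
def checkSyncMid : Prog := seqs [copy 19 9, add 37 8 3,
  forLoop 37 (seqs [checkSyncRight, add 19 19 3])]

/-- Tests all pairs of adjacent windows inside the block that starts at `R_9`. -/
def checkSync : Prog := seqs [copy 18 9, add 36 8 3,
  forLoop 36 (seqs [checkSyncMid, add 18 18 3])]

theorem halts_checkSyncRight {F q m b i j : ℕ} {X : ℕ → ℕ} {s : State} (hc : Consts F q m s)
    (hX : s.arr 0 = X) (h9 : s.reg 9 = b) (h18 : s.reg 18 = b + i) (h19 : s.reg 19 = b + j)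
    (hj : j ≤ m) :
    Halts checkSyncRight (70 * (m + 1) ^ 3) (fun s' => s'.reg 13 = 0 ↔
      s.reg 13 = 0 ∧ ∀ k < m + 1, LcsLe F X (b + i) (b + j) (b + j) (b + k)) s := by
  apply Halts.mono
  · unfold checkSyncRight
    iterate 3 apply halts_basic
    apply halts_cons
    · refine halts_for (N := m + 1) (T := 60 * (m + 1) ^ 2 + 2) (fun k s' => s'.reg 21 = b + k ∧
        (s'.reg 13 = 0 ↔ s.reg 13 = 0 ∧
          ∀ k' < k, LcsLe F X (b + i) (b + j) (b + j) (b + k')))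
        ?_ ?_ (by decide) (by decide) (by decide) ?_ ?_
      · simp [hc.m, hc.one]
      · simp [hc.one]
      · simp [h9, hc.zero]
      · rintro k s' hk ⟨h21, h13⟩ hfr
        have hc' : Consts F q m s' :=
          (((hc.exec (by decide)).exec (by decide)).exec (by decide)).frame hfr (by decide)
        have e18 := hfr.reg 18 (by decide)
        have e19 := hfr.reg 19 (by decide)
        have e20 := hfr.reg 20 (by decide)
        have ea := hfr.arr 0 (by decide)
        simp [h18, h19, hc.zero, hX] at e18 e19 e20 ea
        apply halts_cons
        · exact halts_lcsCheck (M := m + 1) hc'.one hc'.zero hc'.F ea e18 e19 e20 h21 (by omega)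
            (by omega)
        · intro s₁ hs₁ hfr₁
          have f3 := hfr₁.reg 3 (by decide)
          have f21 := hfr₁.reg 21 (by decide)
          rw [hc'.one] at f3
          rw [h21] at f21
          apply halts_basic
          apply halts_nil
          simp only [exec_sub_reg, exec_add_reg, Nat.reduceEqDiff, if_true, if_false]
          rw [f21, f3, hs₁, h13]
          exact ⟨Nat.add_assoc _ _ _, and_forall_lt_succ⟩
    · rintro s₁ ⟨-, h⟩ -
      exact halts_nil h
  · have h1 : m + 1 ≤ (m + 1) ^ 3 := Nat.le_self_pow (by omega) _
    have h2 : (m + 1) * (60 * (m + 1) ^ 2 + 2 + 3) = 60 * (m + 1) ^ 3 + 5 * (m + 1) := by ring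
    omega

theorem halts_checkSyncMid {F q m b i : ℕ} {X : ℕ → ℕ} {s : State} (hc : Consts F q m s)
    (hX : s.arr 0 = X) (h9 : s.reg 9 = b) (h18 : s.reg 18 = b + i) :
    Halts checkSyncMid (80 * (m + 1) ^ 4) (fun s' => s'.reg 13 = 0 ↔
      s.reg 13 = 0 ∧ ∀ j < m + 1, ∀ k < m + 1, LcsLe F X (b + i) (b + j) (b + j) (b + k)) s := by
  apply Halts.mono
  · unfold checkSyncMid
    iterate 2 apply halts_basic
    apply halts_cons
    · refine halts_for (N := m + 1) (T := 70 * (m + 1) ^ 3 + 2) (fun j s' => s'.reg 19 = b + j ∧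
        (s'.reg 13 = 0 ↔ s.reg 13 = 0 ∧ ∀ j' < j, ∀ k < m + 1,
          LcsLe F X (b + i) (b + j') (b + j') (b + k)))
        ?_ ?_ (by decide) (by decide) (by decide) ?_ ?_
      · simp [hc.m, hc.one]
      · simp [hc.one]
      · simp [h9, hc.zero]
      · rintro j s' hj ⟨h19, h13⟩ hfr
        have hc' : Consts F q m s' :=
          ((hc.exec (by decide)).exec (by decide)).frame hfr (by decide)
        have e18 := hfr.reg 18 (by decide)
        have e9 := hfr.reg 9 (by decide)
        have ea := hfr.arr 0 (by decide)
        simp [h18, h9, hX] at e18 e9 ea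
        apply halts_cons
        · exact halts_checkSyncRight hc' ea e9 e18 h19 (by omega)
        · intro s₁ hs₁ hfr₁
          have f3 := hfr₁.reg 3 (by decide)
          have f19 := hfr₁.reg 19 (by decide)
          rw [hc'.one] at f3
          rw [h19] at f19
          apply halts_basic
          apply halts_nil
          simp only [exec_sub_reg, exec_add_reg, Nat.reduceEqDiff, if_true, if_false]
          rw [f19, f3, hs₁, h13]
          exact ⟨Nat.add_assoc _ _ _, and_forall_lt_succ⟩
    · rintro s₁ ⟨-, h⟩ -
      exact halts_nil h
  · have h1 : m + 1 ≤ (m + 1) ^ 4 := Nat.le_self_pow (by omega) _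
    have h2 : (m + 1) * (70 * (m + 1) ^ 3 + 2 + 3) = 70 * (m + 1) ^ 4 + 5 * (m + 1) := by ring
    omega

theorem halts_checkSync {F q m b : ℕ} {X : ℕ → ℕ} {s : State} (hc : Consts F q m s)
    (hX : s.arr 0 = X) (h9 : s.reg 9 = b) :
    Halts checkSync (90 * (m + 1) ^ 5) (fun s' => s'.reg 13 = 0 ↔
      s.reg 13 = 0 ∧ ∀ i < m + 1, ∀ j < m + 1, ∀ k < m + 1,
        LcsLe F X (b + i) (b + j) (b + j) (b + k)) s := by
  apply Halts.mono
  · unfold checkSync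
    iterate 2 apply halts_basic
    apply halts_cons
    · refine halts_for (N := m + 1) (T := 80 * (m + 1) ^ 4 + 2) (fun i s' => s'.reg 18 = b + i ∧
        (s'.reg 13 = 0 ↔ s.reg 13 = 0 ∧ ∀ i' < i, ∀ j < m + 1, ∀ k < m + 1,
          LcsLe F X (b + i') (b + j) (b + j) (b + k)))
        ?_ ?_ (by decide) (by decide) (by decide) ?_ ?_
      · simp [hc.m, hc.one]
      · simp [hc.one]
      · simp [h9, hc.zero]
      · rintro i s' hi ⟨h18, h13⟩ hfr
        have hc' : Consts F q m s' :=
          ((hc.exec (by decide)).exec (by decide)).frame hfr (by decide)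
        have e9 := hfr.reg 9 (by decide)
        have ea := hfr.arr 0 (by decide)
        simp [h9, hX] at e9 ea
        apply halts_cons
        · exact halts_checkSyncMid hc' ea e9 h18
        · intro s₁ hs₁ hfr₁
          have f3 := hfr₁.reg 3 (by decide)
          have f18 := hfr₁.reg 18 (by decide)
          rw [hc'.one] at f3
          rw [h18] at f18
          apply halts_basic
          apply halts_nil
          simp only [exec_sub_reg, exec_add_reg, Nat.reduceEqDiff, if_true, if_false]
          rw [f18, f3, hs₁, h13]
          exact ⟨Nat.add_assoc _ _ _, and_forall_lt_succ⟩
    · rintro s₁ ⟨-, h⟩ -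
      exact halts_nil h
  · have h1 : m + 1 ≤ (m + 1) ^ 5 := Nat.le_self_pow (by omega) _
    have h2 : (m + 1) * (80 * (m + 1) ^ 4 + 2 + 3) = 80 * (m + 1) ^ 5 + 5 * (m + 1) := by ring
    omega

/-- Tests the block that starts at `R_9` against all earlier blocks. -/
def checkFar : Prog := seqs [con 18 0, copy 39 9,
  .loop 39 (seqs [add 19 18 8, copy 20 9, add 21 9 8, lcsCheck, copy 18 19, sub 39 39 8])]

/-- The remaining distance `k * m` serves as loop counter, so the block index `T` never has to be
computed. -/
theorem halts_checkFar {F q m T : ℕ} {X : ℕ → ℕ} {s : State} (hc : Consts F q m s)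
    (hX : s.arr 0 = X) (h9 : s.reg 9 = T * m) :
    Halts checkFar (80 * (T + 1) * (m + 1) ^ 2) (fun s' => s'.reg 13 = 0 ↔
      s.reg 13 = 0 ∧ ∀ t < T, LcsLe F X (t * m) (t * m + m) (T * m) (T * m + m)) s := by
  apply Halts.mono
  · unfold checkFar
    iterate 2 apply halts_basic
    apply halts_cons
    · refine halts_loop (T := 60 * (m + 1) ^ 2 + 6) (fun k s' => k ≤ T ∧ s'.reg 39 = k * m ∧
        s'.reg 18 = (T - k) * m ∧ (s'.reg 13 = 0 ↔ s.reg 13 = 0 ∧ ∀ t < T - k,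
          LcsLe F X (t * m) (t * m + m) (T * m) (T * m + m))) T ?_ ?_
      · simp [h9, hc.zero]
      · rintro k s' ⟨hkT, h39, h18, h13⟩ hne hfr
        have hc' : Consts F q m s' :=
          ((hc.exec (by decide)).exec (by decide)).frame hfr (by decide)
        have e9 := hfr.reg 9 (by decide)
        have ea := hfr.arr 0 (by decide)
        simp [h9, hX] at e9 ea
        obtain ⟨k, rfl⟩ : ∃ k', k = k' + 1 :=
          Nat.exists_eq_succ_of_ne_zero (by rintro rfl; simp [h39] at hne)
        iterate 3 apply halts_basic
        apply halts_cons
        · exact halts_lcsCheck (F := F) (i := (T - (k + 1)) * m) (j := (T - (k + 1)) * m + m)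
            (l := T * m) (k := T * m + m) (X := X) (M := m + 1)
            (by simp [hc'.one]) (by simp [hc'.zero]) (by simp [hc'.F]) (by simp [ea])
            (by simp [h18]) (by simp [h18, hc'.m]) (by simp [e9, hc'.zero])
            (by simp [e9, hc'.m]) (by omega) (by omega)
        · intro s₁ hs₁ hfr₁
          have f8 := hfr₁.reg 8 (by decide)
          have f40 := hfr₁.reg 40 (by decide)
          have f19 := hfr₁.reg 19 (by decide)
          have f39 := hfr₁.reg 39 (by decide)
          simp [hc'.m, hc'.zero, h18, h39] at f8 f40 f19 f39 hs₁
          iterate 2 apply halts_basic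
          apply halts_nil
          have hT : T - k = T - (k + 1) + 1 := by omega
          refine ⟨k, by omega, by omega, ?_, ?_, ?_⟩
          · simp [f39, f8, Nat.add_mul]
          · simp [f19, f40, hT, Nat.add_mul]
          · rw [hT, Nat.forall_lt_succ_right, ← and_assoc, ← h13]
            simpa using hs₁
    · rintro s₁ ⟨hz, k, hk, h39, -, h⟩ -
      apply halts_nil
      rw [hz] at h39
      rcases Nat.eq_zero_or_pos k with rfl | hk0
      · simpa using h
      -- For empty blocks the counter vanishes at once, but then every remaining test holds
      -- trivially.
      · obtain rfl : m = 0 := by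
          rcases Nat.mul_eq_zero.1 h39.symm with h | h <;> omega
        rw [h]
        simp [LcsLe]
  · have h1 : 1 ≤ (m + 1) ^ 2 := Nat.one_le_pow _ _ (by omega)
    have h2 : T * (60 * (m + 1) ^ 2 + 6 + 1) ≤ T * (67 * (m + 1) ^ 2) :=
      Nat.mul_le_mul_left _ (by omega)
    have h3 : 80 * (T + 1) * (m + 1) ^ 2 =
      T * (67 * (m + 1) ^ 2) + 13 * (T * (m + 1) ^ 2) + 80 * (m + 1) ^ 2 := by ring
    omega

/-! ### Exhaustive search and greedy assembly of the blocks -/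

/-- `X` with the cells `b, …, b + m - 1` replaced by `w 0, …, w (m - 1)`. -/
def setBlock (X : ℕ → ℕ) (b m : ℕ) (w : ℕ → ℕ) (p : ℕ) : ℕ :=
  if b ≤ p ∧ p < b + m then w (p - b) else X p

theorem setBlock_setBlock (X : ℕ → ℕ) (b m : ℕ) (w w' : ℕ → ℕ) :
    setBlock (setBlock X b m w) b m w' = setBlock X b m w' := by
  funext p
  unfold setBlock
  split_ifs <;> rfl

/-- Division of `R_14` by `R_6`: the quotient goes to `R_15`, the remainder to `R_14`. -/
def divide : Prog := seqs [con 15 0, add 16 14 3, sub 16 16 6,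
  .loop 16 (seqs [sub 14 14 6, add 15 15 3, add 16 14 3, sub 16 16 6])]

/-- Division by repeated subtraction takes time linear in `v`, which is affordable because the codes
stay below `q ^ m`. -/
theorem halts_divide {F q m v : ℕ} {s : State} (hc : Consts F q m s) (hq : 0 < q)
    (h14 : s.reg 14 = v) :
    Halts divide (6 * v + 5) (fun s' => s'.reg 14 = v % q ∧ s'.reg 15 = v / q) s := by
  apply Halts.mono
  · unfold divide
    iterate 3 apply halts_basic
    apply halts_cons
    · refine halts_loop (T := 5) (fun k s' => s'.reg 14 = k ∧ k + q * s'.reg 15 = v ∧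
        s'.reg 16 = k + 1 - q) v ?_ ?_
      · simp [h14, hc.one, hc.q]
      · rintro k s' ⟨e14, e15, e16⟩ hne hfr
        have hc' : Consts F q m s' :=
          (((hc.exec (by decide)).exec (by decide)).exec (by decide)).frame hfr (by decide)
        iterate 4 apply halts_basic
        apply halts_nil
        refine ⟨k - q, by omega, ?_, ?_, ?_⟩
        · simp [e14, hc'.q]
        · simp only [exec_sub_reg, exec_add_reg, Nat.reduceEqDiff, if_true, if_false]
          rw [hc'.one, Nat.mul_add]
          omega
        · simp [e14, hc'.one, hc'.q]
    · rintro s₁ ⟨hz, k, h14, h15, h16⟩ -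
      apply halts_nil
      have := (Nat.div_mod_unique hq).2 ⟨h15, by omega⟩
      rw [h14]
      exact ⟨this.2.symm, this.1.symm⟩
  · omega

/-- Writes the digits of `R_12` in base `R_6`, shifted by `R_11`, into the block that starts at
`R_9`. -/
def decode : Prog := seqs [copy 14 12, copy 17 9, copy 22 8,
  forLoop 22 (seqs [divide, add 16 14 11, store 0 17 16, copy 14 15, add 17 17 3])]

theorem halts_decode {F q m b off c Q : ℕ} {X : ℕ → ℕ} {s : State} (hc : Consts F q m s)
    (hq : 0 < q) (hX : s.arr 0 = X) (h9 : s.reg 9 = b) (h11 : s.reg 11 = off)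
    (h12 : s.reg 12 = c) (hcQ : c ≤ Q) :
    Halts decode (m * (6 * Q + 13) + 5)
      (fun s' => s'.arr 0 = setBlock X b m fun p => digit q c p + off) s := by
  apply Halts.mono
  · unfold decode
    iterate 3 apply halts_basic
    apply halts_cons
    · refine halts_for (N := m) (T := 6 * Q + 10) (fun j s' => s'.reg 14 = c / q ^ j ∧
        s'.reg 17 = b + j ∧ s'.arr 0 = setBlock X b j fun p => digit q c p + off)
        ?_ ?_ (by decide) (by decide) (by decide) ?_ ?_
      · simp [hc.m, hc.zero]
      · simp [hc.one]
      · simp [h9, h12, hc.zero, hX]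
        funext p
        unfold setBlock
        rw [if_neg (by omega)]
      · rintro j s' hj ⟨h14, h17, hA⟩ hfr
        have hc' : Consts F q m s' :=
          (((hc.exec (by decide)).exec (by decide)).exec (by decide)).frame hfr (by decide)
        have e11 := hfr.reg 11 (by decide)
        simp [h11] at e11
        have hle : c / q ^ j ≤ Q := (Nat.div_le_self _ _).trans hcQ
        refine Halts.mono (T := 6 * (c / q ^ j) + 5 + 5) ?_ (by omega)
        apply halts_cons (halts_divide hc' hq h14)
        rintro s₁ ⟨f14, f15⟩ hfr₁
        have hc₁ : Consts F q m s₁ := hc'.frame hfr₁ (by decide)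
        have f11 := hfr₁.reg 11 (by decide)
        have f17 := hfr₁.reg 17 (by decide)
        have fA := hfr₁.arr 0 (by decide)
        rw [e11] at f11
        rw [h17] at f17
        rw [hA] at fA
        iterate 4 apply halts_basic
        apply halts_nil
        refine ⟨?_, ?_, ?_⟩
        · simp [f15, hc₁.zero, pow_succ, Nat.div_div_eq_div_mul]
        · simp [f17, hc₁.one, Nat.add_assoc]
        · funext p
          simp [f14, f11, f17, fA]
          unfold setBlock
          by_cases hp : p = b + j
          · subst hp
            rw [if_pos rfl, if_pos (by omega), Nat.add_sub_cancel_left]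
            rfl
          · rw [if_neg hp]
            by_cases hpb : b ≤ p ∧ p < b + j
            · rw [if_pos hpb, if_pos (by omega)]
            · rw [if_neg hpb, if_neg (by omega)]
    · rintro s₁ ⟨-, -, h⟩ -
      exact halts_nil h
  · rw [show 6 * Q + 10 + 3 = 6 * Q + 13 from rfl]

/-- The block `[T * m, T * m + m)` of `X` passes all tests. -/
def BlockOK (F m T : ℕ) (X : ℕ → ℕ) : Prop :=
  SyncOn F X (T * m) (T * m + m) ∧
    ∀ t < T, ∀ r, HasMatching X X (t * m) (t * m + m) (T * m) (T * m + m) r → F * r ≤ 2 * m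

/-- The program tests all triples of cut points, ordered or not: in a badly ordered triple one
window is empty, so its test succeeds. -/
theorem blockOK_iff {F m T : ℕ} {X : ℕ → ℕ} : BlockOK F m T X ↔
    (∀ i < m + 1, ∀ j < m + 1, ∀ k < m + 1,
      LcsLe F X (T * m + i) (T * m + j) (T * m + j) (T * m + k)) ∧
    ∀ t < T, LcsLe F X (t * m) (t * m + m) (T * m) (T * m + m) := by
  unfold BlockOK
  simp only [lcsLe_iff]
  refine and_congr ⟨fun h i hi j hj k hk r hr => ?_, fun h i j k r hi hij hjk hk hr => ?_⟩
    (forall_congr' fun t => forall_congr' fun ht => forall_congr' fun r => ?_)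
  · have h1 := hr.le_left
    have h2 := hr.swap.le_left
    rcases Nat.eq_zero_or_pos r with rfl | hr0
    · simp
    · have := h _ _ _ r (by omega) (by omega) (by omega) (by omega) hr
      omega
  · have := h (i - T * m) (by omega) (j - T * m) (by omega) (k - T * m) (by omega) r
    rw [Nat.add_sub_cancel' hi, Nat.add_sub_cancel' (by omega), Nat.add_sub_cancel' (by omega)]
      at this
    have := this hr
    omega
  · rw [show t * m + m - t * m + (T * m + m - T * m) = 2 * m by omega]

theorem BlockOK.congr {F m T : ℕ} {X X' : ℕ → ℕ} (h : BlockOK F m T X)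
    (hX : ∀ p < T * m + m, X p = X' p) : BlockOK F m T X' := by
  refine ⟨fun i j k r hi hij hjk hk hr => ?_, fun t ht r hr => ?_⟩
  · exact h.1 i j k r hi hij hjk hk (hr.congr (fun p _ hp => (hX p (by omega)).symm)
      fun p _ hp => (hX p (by omega)).symm)
  · have : (t + 1) * m ≤ T * m := Nat.mul_le_mul_right m ht
    rw [Nat.add_mul, Nat.one_mul] at this
    exact h.2 t ht r (hr.congr (fun p _ hp => (hX p (by omega)).symm)
      fun p _ hp => (hX p (by omega)).symm)

theorem exists_blockOK {a h T : ℕ} (ha : 0 < a) (hT : T < 2 ^ h) (X : ℕ → ℕ) (off : ℕ) :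
    ∃ c < (128 * (2 * a) ^ 3) ^ (a * h), BlockOK (2 * a) (a * h) T
      (setBlock X (T * (a * h)) (a * h) fun p => digit (128 * (2 * a) ^ 3) c p + off) := by
  obtain ⟨c, hc, h1, h2⟩ := exists_code ha hT X off
  generalize 128 * (2 * a) ^ 3 = q at *
  set m := a * h with hm
  refine ⟨c, hc, fun i j k r hi hij hjk hk hr => ?_, fun t ht r hr => ?_⟩
  · obtain ⟨f, g, f1, f2⟩ := hr
    have := h1 (i - T * m) (j - T * m) (k - T * m) r (Nat.zero_le _) (by omega) (by omega)
      (by omega) ⟨fun s => f s - T * m, fun s => g s - T * m, fun s hs => ?_, fun s t hst ht => ?_⟩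
    · omega
    · obtain ⟨e1, e2, e3⟩ := f1 s hs
      rw [setBlock, setBlock, if_pos (by omega), if_pos (by omega)] at e3
      exact ⟨by dsimp only; omega, by dsimp only; omega, Nat.add_right_cancel e3⟩
    · have e1 := f1 s (hst.trans ht)
      have e2 := f1 t ht
      have e3 := f2 s t hst ht
      dsimp only
      omega
  · have htm : (t + 1) * m ≤ T * m := Nat.mul_le_mul_right m ht
    rw [Nat.add_mul, Nat.one_mul] at htm
    obtain ⟨f, g, f1, f2⟩ := hr
    have := h2 t ht r ⟨f, fun s => g s - T * m, fun s hs => ?_, fun s t hst ht => ?_⟩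
    · calc 2 * a * r ≤ 2 * a * h := Nat.mul_le_mul_left _ this
        _ = 2 * m := by rw [hm, Nat.mul_assoc]
    · obtain ⟨e1, e2, e3⟩ := f1 s hs
      rw [setBlock, setBlock, if_neg (by omega), if_pos (by omega)] at e3
      exact ⟨e1, by dsimp only; omega, e3⟩
    · have e1 := f1 s (hst.trans ht)
      have e2 := f1 t ht
      have e3 := f2 s t hst ht
      dsimp only
      omega

/-- Finds the first code whose block passes all tests. -/
def search : Prog := seqs [con 12 0, con 13 1,
  .loop 13 (seqs [con 13 0, decode, checkSync, checkFar, add 12 12 3])]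

theorem halts_search {F q m T off Q : ℕ} {X : ℕ → ℕ} {s : State} (hc : Consts F q m s)
    (hq : 0 < q) (hX : s.arr 0 = X) (h9 : s.reg 9 = T * m) (h11 : s.reg 11 = off)
    (hex : ∃ c < Q, BlockOK F m T (setBlock X (T * m) m fun p => digit q c p + off))
    (hm : m + 1 ≤ Q) (hT : T + 1 ≤ Q) :
    Halts search (300 * Q ^ 6) (fun s' => ∃ c, BlockOK F m T (s'.arr 0) ∧
      s'.arr 0 = setBlock X (T * m) m fun p => digit q c p + off) s := by
  obtain ⟨c₀, hc₀, hok⟩ := hex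
  apply Halts.mono
  · unfold search
    iterate 2 apply halts_basic
    apply halts_cons
    · refine halts_loop (T := m * (6 * Q + 13) + 90 * (m + 1) ^ 5 + 80 * (T + 1) * (m + 1) ^ 2 + 8)
        -- While the flag is up, the current code has not passed the known solution `c₀`, so the
        -- search ends there at the latest, possibly at an earlier good code. The last clause says
        -- that failed candidates have altered only the current block.
        (fun k s' => (s'.reg 13 ≠ 0 → k = c₀ - s'.reg 12 + 1 ∧ s'.reg 12 ≤ c₀) ∧
          (s'.reg 13 = 0 → k = 0 ∧ ∃ c, BlockOK F m T (s'.arr 0) ∧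
            s'.arr 0 = setBlock X (T * m) m fun p => digit q c p + off) ∧
          ∀ w, setBlock (s'.arr 0) (T * m) m w = setBlock X (T * m) m w) (c₀ + 1) ?_ ?_
      · simp [hX]
      · rintro k s' ⟨h1, -, h3⟩ hne hfr
        have hc' : Consts F q m s' :=
          ((hc.exec (by decide)).exec (by decide)).frame hfr (by decide)
        have e9 := hfr.reg 9 (by decide)
        have e11 := hfr.reg 11 (by decide)
        simp [h9, h11] at e9 e11
        obtain ⟨hk, hle⟩ := h1 hne
        set c := s'.reg 12 with hcdef
        apply Halts.mono
        · apply halts_basic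
          apply halts_cons
          · exact halts_decode (X := s'.arr 0) (b := T * m) (off := off) (c := c) (Q := Q)
              (hc'.exec (by decide)) hq (by simp) (by simp [e9]) (by simp [e11]) (by simp [hcdef])
              (by omega)
          intro s₁ hA hfr₁
          have hc₁ := (hc'.exec (I := .const 13 0) (by decide)).frame hfr₁ (by decide)
          have f9 := hfr₁.reg 9 (by decide)
          have f12 := hfr₁.reg 12 (by decide)
          have f13 := hfr₁.reg 13 (by decide)
          simp [e9, ← hcdef] at f9 f12 f13
          rw [h3] at hA
          apply halts_cons (halts_checkSync hc₁ hA f9)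
          intro s₂ hs₂ hfr₂
          have hc₂ := hc₁.frame hfr₂ (by decide)
          have g9 := (hfr₂.reg 9 (by decide)).trans f9
          have g12 := (hfr₂.reg 12 (by decide)).trans f12
          have gA := (hfr₂.arr 0 (by decide)).trans hA
          apply halts_cons (halts_checkFar hc₂ gA g9)
          intro s₃ hs₃ hfr₃
          have hc₃ := hc₂.frame hfr₃ (by decide)
          have i12 := (hfr₃.reg 12 (by decide)).trans g12
          have iA := (hfr₃.arr 0 (by decide)).trans gA
          rw [hs₂, and_assoc, ← blockOK_iff] at hs₃
          simp only [f13, true_and] at hs₃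
          apply halts_basic
          apply halts_nil
          by_cases hB : BlockOK F m T (setBlock X (T * m) m fun p => digit q c p + off)
          · have i13 := hs₃.2 hB
            refine ⟨0, by omega, ?_, ?_, ?_⟩
            · simp [i13]
            · intro _
              exact ⟨rfl, c, by simpa [iA] using hB, by simp [iA]⟩
            · simp [iA, setBlock_setBlock]
          · have i13 := mt hs₃.1 hB
            have hcne : c ≠ c₀ := by
              intro h
              exact hB (h ▸ hok)
            refine ⟨c₀ - (c + 1) + 1, by omega, ?_, ?_, ?_⟩
            · simp [i12, hc₃.one]
              omega
            · simp [i13]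
            · simp [iA, setBlock_setBlock]
        · omega
    · rintro s₁ ⟨hz, k, -, h, -⟩ -
      exact halts_nil (h hz).2
  · have hQ1 : 1 ≤ Q := by omega
    have h1 : m * (6 * Q + 13) ≤ 19 * Q ^ 5 := by
      calc m * (6 * Q + 13) ≤ Q * (19 * Q) := Nat.mul_le_mul (by omega) (by omega)
        _ = 19 * Q ^ 2 := by ring
        _ ≤ 19 * Q ^ 5 := Nat.mul_le_mul_left _ (Nat.pow_le_pow_right hQ1 (by norm_num))
    have h2 : (m + 1) ^ 5 ≤ Q ^ 5 := Nat.pow_le_pow_left hm 5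
    have h3 : 80 * (T + 1) * (m + 1) ^ 2 ≤ 80 * Q ^ 5 := by
      calc 80 * (T + 1) * (m + 1) ^ 2 ≤ 80 * Q * Q ^ 2 :=
            Nat.mul_le_mul (by omega) (Nat.pow_le_pow_left hm 2)
        _ = 80 * Q ^ 3 := by ring
        _ ≤ 80 * Q ^ 5 := Nat.mul_le_mul_left _ (Nat.pow_le_pow_right hQ1 (by norm_num))
    have h4 : 1 ≤ Q ^ 5 := Nat.one_le_pow _ _ hQ1
    have h5 : 1 ≤ Q ^ 6 := Nat.one_le_pow _ _ hQ1
    calc (c₀ + 1) * (m * (6 * Q + 13) + 90 * (m + 1) ^ 5 + 80 * (T + 1) * (m + 1) ^ 2 + 8 + 1) + 1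
          + 1 + 1 + 1 ≤ Q * (198 * Q ^ 5) + 4 := by
          have := Nat.mul_le_mul (show c₀ + 1 ≤ Q from hc₀)
            (show m * (6 * Q + 13) + 90 * (m + 1) ^ 5 + 80 * (T + 1) * (m + 1) ^ 2 + 8 + 1 ≤
              198 * Q ^ 5 by omega)
          omega
      _ = 198 * Q ^ 6 + 4 := by ring
      _ ≤ 300 * Q ^ 6 := by omega

/-- Constructs the string block by block; the shift in `R_11` implements the colours. -/
def blocks : Prog := seqs [con 9 0, copy 10 0, add 11 6 6,
  .loop 10 (seqs [search, sub 11 6 11, add 9 9 8, sub 10 10 8])]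

/-- Starting from `2 * q`, truncated subtraction from `q` produces the shifts `0, q, 0, q, …`, so
one instruction advances the colour. -/
theorem colour_succ (q T : ℕ) : q - q * colour T = q * colour (T + 1) := by
  unfold colour
  rcases Nat.eq_zero_or_pos T with rfl | hT
  · simp; omega
  · rw [if_neg (by omega), if_neg (by omega)]
    rcases Nat.mod_two_eq_zero_or_one T with h | h
    · rw [show (T + 1) % 2 = 1 by omega, show (T + 1 + 1) % 2 = 0 by omega]; simp
    · rw [show (T + 1) % 2 = 0 by omega, show (T + 1 + 1) % 2 = 1 by omega]; simp

/-- Every block is searched at full length, including the last one, whose part beyond `n` is simply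
not output. The number of earlier blocks is below `n < 2 ^ h`, as the existence lemma requires. -/
theorem halts_blocks {a h n q m : ℕ} {s : State} (ha : 0 < a) (hh : 0 < h)
    (hqd : q = 128 * (2 * a) ^ 3) (hmd : m = a * h) (hc : Consts (2 * a) q m s)
    (h0 : s.reg 0 = n) (hn : n < 2 ^ h) :
    Halts blocks (400 * (q ^ m) ^ 7) (fun s' => (∀ T, T * m < n → BlockOK (2 * a) m T (s'.arr 0)) ∧
      ∀ p < n, ∃ d < q, s'.arr 0 p = d + q * colour (p / m)) s := by
  have hm : 0 < m := by rw [hmd]; positivity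
  have hq : 2 ≤ q := by
    have : 0 < a ^ 3 := by positivity
    rw [hqd, mul_pow]
    omega
  set Q := q ^ m with hQ
  have hmQ : m + 1 ≤ Q := Nat.lt_pow_self (by omega)
  have hnQ : n ≤ Q := by
    calc n ≤ 2 ^ h := hn.le
      _ ≤ 2 ^ m := Nat.pow_le_pow_right (by norm_num) (by rw [hmd]; exact Nat.le_mul_of_pos_left h ha)
      _ ≤ q ^ m := Nat.pow_le_pow_left hq m
  apply Halts.mono
  · unfold blocks
    iterate 3 apply halts_basic
    apply halts_cons
    · refine halts_loop (T := 300 * Q ^ 6 + 4) (fun k s' => k = s'.reg 10 ∧ ∃ T,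
        s'.reg 9 = T * m ∧ s'.reg 10 = n - T * m ∧ s'.reg 11 = q * colour T ∧
        (∀ t < T, BlockOK (2 * a) m t (s'.arr 0)) ∧
        ∀ p < T * m, ∃ d < q, s'.arr 0 p = d + q * colour (p / m)) n ?_ ?_
      · simp only [exec_add_reg, exec_const_reg, Nat.reduceEqDiff, if_true, if_false]
        rw [h0, hc.zero, hc.q]
        refine ⟨rfl, 0, by simp, by simp, ?_, by simp, by simp⟩
        simp [colour]; omega
      · rintro k s' ⟨hk, T, h9, h10, h11, hT, hp⟩ hne hfr
        have hc' : Consts (2 * a) q m s' :=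
          (((hc.exec (by decide)).exec (by decide)).exec (by decide)).frame hfr (by decide)
        have hTn : T * m < n := by omega
        have hTn' : T < n := (Nat.le_mul_of_pos_right T hm).trans_lt hTn
        have hex := exists_blockOK ha (hTn'.trans hn) (s'.arr 0) (q * colour T)
        rw [← hqd, ← hmd, ← hQ] at hex
        apply halts_cons
        · exact halts_search (Q := Q) hc' (by omega) rfl h9 h11 hex hmQ (by omega)
        rintro s₁ ⟨c, hB, hA⟩ hfr₁
        have hc₁ := hc'.frame hfr₁ (by decide)
        have f9 := (hfr₁.reg 9 (by decide)).trans h9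
        have f10 := (hfr₁.reg 10 (by decide)).trans h10
        have f11 := (hfr₁.reg 11 (by decide)).trans h11
        iterate 3 apply halts_basic
        apply halts_nil
        have hold : ∀ p < T * m, s'.arr 0 p = s₁.arr 0 p := by
          intro p hp
          rw [hA, setBlock, if_neg (by omega)]
        refine ⟨_, ?_, rfl, T + 1, ?_, ?_, ?_, ?_, ?_⟩
        · simp [f10, hc₁.m]; omega
        · simp [f9, hc₁.m, Nat.add_mul]
        · simp [f10, hc₁.m, Nat.add_mul]; omega
        · simp [f11, hc₁.q, colour_succ]
        · intro t ht
          simp only [exec_sub_arr, exec_add_arr]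
          rcases Nat.lt_succ_iff_lt_or_eq.1 ht with ht | rfl
          · refine (hT t ht).congr fun p hp => hold p ?_
            have : (t + 1) * m ≤ T * m := Nat.mul_le_mul_right m ht
            rw [Nat.add_mul, Nat.one_mul] at this
            omega
          · exact hB
        · intro p hpT
          simp only [exec_sub_arr, exec_add_arr]
          by_cases hlt : p < T * m
          · rw [← hold p hlt]
            exact hp p hlt
          · rw [Nat.add_mul, Nat.one_mul] at hpT
            refine ⟨digit q c (p - T * m), digit_lt (by omega) _ _, ?_⟩
            rw [hA, setBlock, if_pos (by omega), show p / m = T from ?_]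
            exact Nat.div_eq_of_lt_le (by omega) (by rw [Nat.add_mul]; omega)
    · rintro s₁ ⟨hz, k, -, T, -, h10, -, hT, hp⟩ -
      apply halts_nil
      rw [hz] at h10
      have hnT : n ≤ T * m := by omega
      exact ⟨fun t ht => hT t (Nat.lt_of_mul_lt_mul_right (ht.trans_le hnT)),
        fun p hpn => hp p (by omega)⟩
  · have h1 : n * (300 * Q ^ 6 + 4 + 1) ≤ Q * (305 * Q ^ 6) := by
      have : 1 ≤ Q ^ 6 := Nat.one_le_pow _ _ (by omega)
      exact Nat.mul_le_mul hnQ (by omega)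
    have h2 : Q * (305 * Q ^ 6) = 305 * Q ^ 7 := by ring
    have h3 : 1 ≤ Q ^ 7 := Nat.one_le_pow _ _ (by omega)
    omega

/-! ### Computing the parameters and splitting into cases -/

/-- `R_d := R_u * R_v` -/
def mul (d u v : ℕ) : Prog := seqs [con d 0, copy 16 v, forLoop 16 (seqs [add d d u])]

theorem halts_mul {d u v x y : ℕ} {s : State} (h3 : s.reg 3 = 1) (h40 : s.reg 40 = 0)
    (hu : s.reg u = x) (hv : s.reg v = y) (hd : d ∉ [3, 16, 40, u, v]) (hu16 : u ≠ 16) :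
    Halts (mul d u v) (5 * y + 5) (fun s' => s'.reg d = x * y) s := by
  simp only [List.mem_cons, List.not_mem_nil, or_false, not_or] at hd
  obtain ⟨d3, d16, d40, du, dv⟩ := hd
  apply Halts.mono
  · unfold mul
    iterate 2 apply halts_basic
    apply halts_cons
    · refine halts_for (N := y) (T := 2) (fun k s' => s'.reg d = x * k)
        ?_ ?_ ?_ ?_ (by decide) ?_ ?_
      · simp [hv, h40, Ne.symm dv, Ne.symm d40]
      · simp [h3, Ne.symm d3]
      · simp [seqs, Prog.regs, Instr.regs, Ne.symm d16]
      · simp [seqs, Prog.regs, Instr.regs, Ne.symm d3]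
      · simp [d16]
      · intro k s' hk hd hfr
        have eu := hfr.reg u (by simp [forLoop, seqs, Prog.regs, Instr.regs, Ne.symm du, hu16])
        simp [hu16, hu, Ne.symm du] at eu
        apply halts_basic
        apply halts_nil
        simp [d16, hd, eu, Nat.mul_add]
    · intro s₁ h _
      exact halts_nil h
  · omega

/-- The case of long strings. -/
def longCase : Prog := seqs [con 7 0, con 14 1, add 16 0 3, sub 16 16 14,
  .loop 16 (seqs [add 14 14 14, add 7 7 3, add 16 0 3, sub 16 16 14]),
  con 15 8, mul 14 4 15, mul 8 14 7, blocks]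

/-- The case of short strings: all symbols are distinct. -/
def shortCase : Prog := seqs [copy 16 0, con 17 0, forLoop 16 (seqs [store 0 17 17, add 17 17 3])]

theorem halts_shortCase {n : ℕ} {s : State} (h3 : s.reg 3 = 1) (h40 : s.reg 40 = 0)
    (h0 : s.reg 0 = n) : Halts shortCase (6 * n + 4) (fun s' => ∀ p < n, s'.arr 0 p = p) s := by
  apply Halts.mono
  · unfold shortCase
    iterate 2 apply halts_basic
    apply halts_cons
    · refine halts_for (N := n) (T := 3) (fun k s' => s'.reg 17 = k ∧ ∀ p < k, s'.arr 0 p = p)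
        ?_ ?_ (by decide) (by decide) (by decide) ?_ ?_
      · simp [h0, h40]
      · simp [h3]
      · simp
      · rintro k s' hk ⟨h17, hp⟩ hfr
        have e3 := hfr.reg 3 (by decide)
        simp [h3] at e3
        iterate 2 apply halts_basic
        apply halts_nil
        simp [h17, e3]
        intro p hpk
        by_cases hpk' : p = k
        · simp [hpk']
        · simp [hpk', hp p (by omega)]
    · rintro s₁ ⟨-, h⟩ -
      exact halts_nil h
  · omega

theorem halts_longCase {E n q h m : ℕ} {s : State} (hE : 0 < E) (hn : 0 < n) (h3 : s.reg 3 = 1)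
    (h40 : s.reg 40 = 0) (h0 : s.reg 0 = n) (h4 : s.reg 4 = E) (h5 : s.reg 5 = 16 * E)
    (h6 : s.reg 6 = q) (hq : q = 128 * (16 * E) ^ 3) (hh : h = Nat.log 2 n + 1)
    (hm : m = 8 * E * h) :
    Halts longCase (1000 * (q ^ m) ^ 7) (fun s' =>
      (∀ T, T * m < n → BlockOK (16 * E) m T (s'.arr 0)) ∧
      ∀ p < n, ∃ d < q, s'.arr 0 p = d + q * colour (p / m)) s := by
  apply Halts.mono
  · unfold longCase
    iterate 4 apply halts_basic
    apply halts_cons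
    -- Doubling continues while `2 ^ j ≤ n`, so it stops exactly at `j = Nat.log 2 n + 1`.
    · refine halts_loop (T := 5) (fun k s' => ∃ j ≤ h, k = h - j ∧ s'.reg 7 = j ∧
        s'.reg 14 = 2 ^ j ∧ s'.reg 16 = n + 1 - 2 ^ j) h ?_ ?_
      · exact ⟨0, Nat.zero_le _, by simp [h0, h3]⟩
      · rintro k s' ⟨j, hj, hk, h7, h14, h16⟩ hne hfr
        have e3 := hfr.reg 3 (by decide)
        have e0 := hfr.reg 0 (by decide)
        simp [h3, h0] at e3 e0
        have hjn : j ≤ Nat.log 2 n := Nat.le_log_of_pow_le (by norm_num) (by omega)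
        iterate 4 apply halts_basic
        apply halts_nil
        refine ⟨h - (j + 1), by omega, j + 1, by omega, rfl, ?_, ?_, ?_⟩
        · simp [h7, e3]
        · simp [h14, pow_succ, mul_two]
        · simp [h14, e0, e3, pow_succ, mul_two]
    rintro s₁ ⟨hz, k, j, hj, -, h7, -, h16⟩ hfr₁
    have hjh : j = h := by
      have : n < 2 ^ j := by omega
      have := Nat.log_lt_of_lt_pow (by omega) this
      omega
    subst hjh
    have e0 := hfr₁.reg 0 (by decide)
    have e3 := hfr₁.reg 3 (by decide)
    have e4 := hfr₁.reg 4 (by decide)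
    have e5 := hfr₁.reg 5 (by decide)
    have e6 := hfr₁.reg 6 (by decide)
    have e40 := hfr₁.reg 40 (by decide)
    simp [h0, h3, h4, h5, h6, h40] at e0 e3 e4 e5 e6 e40
    apply halts_basic
    apply halts_cons
    · exact halts_mul (x := E) (y := 8) (by simp [e3]) (by simp [e40]) (by simp [e4]) (by simp)
        (by decide) (by decide)
    intro s₂ h14 hfr₂
    have f0 := hfr₂.reg 0 (by decide)
    have f3 := hfr₂.reg 3 (by decide)
    have f5 := hfr₂.reg 5 (by decide)
    have f6 := hfr₂.reg 6 (by decide)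
    have f7 := hfr₂.reg 7 (by decide)
    have f40 := hfr₂.reg 40 (by decide)
    simp [e0, e3, e5, e6, h7, e40] at f0 f3 f5 f6 f7 f40
    apply halts_cons
    · exact halts_mul f3 f40 h14 f7 (by decide) (by decide)
    intro s₃ h8 hfr₃
    apply halts_cons
    · refine halts_blocks (a := 8 * E) (h := j) (n := n) (q := q) (m := m) (by omega) (by omega)
        ?_ hm ⟨?_, ?_, ?_, ?_, ?_⟩ ?_ ?_
      · rw [hq]; ring
      · rw [hfr₃.reg 3 (by decide), f3]
      · rw [hfr₃.reg 40 (by decide), f40]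
      · rw [hfr₃.reg 5 (by decide), f5]; ring
      · rw [hfr₃.reg 6 (by decide), f6]
      · rw [h8, hm]; ring
      · rw [hfr₃.reg 0 (by decide), f0]
      · rw [hh]; exact Nat.lt_pow_succ_log_self (by norm_num) n
    rintro s₄ hs₄ -
    apply halts_nil
    rwa [show 2 * (8 * E) = 16 * E by ring] at hs₄
  · have hq2 : 2 ≤ q := by
      have : 0 < E ^ 3 := by positivity
      rw [hq, mul_pow]
      omega
    have hmQ : m < q ^ m := Nat.lt_pow_self (by omega)
    have hhm : h ≤ m := by rw [hm]; exact Nat.le_mul_of_pos_left h (by omega)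
    have h7 : q ^ m ≤ (q ^ m) ^ 7 := Nat.le_self_pow (by norm_num) _
    omega

/-- Computes `E = ⌈b / a⌉` and `q = 128 * (16 * E) ^ 3`, and compares `n` with `q`. -/
def mainCase : Prog := seqs [copy 14 2, .loop 14 (seqs [sub 14 14 1, add 4 4 3]),
  con 15 16, mul 5 4 15, mul 14 5 5, mul 7 14 5, con 15 128, mul 6 7 15,
  sub 16 0 6, .branch 16 longCase shortCase]

/-- The program that constructs synchronization circles. -/
def construct : Prog := seqs [con 3 1, sub 16 0 3, .branch 16 mainCase (seqs [])]

/-- The output is either the string of `n` distinct symbols or consists of tested, coloured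
blocks. -/
def IsOutput (E n q m : ℕ) (s : State) : Prop :=
  (n ≤ q ∧ ∀ p < n, s.arr 0 p = p) ∨
    (q < n ∧ (∀ T, T * m < n → BlockOK (16 * E) m T (s.arr 0)) ∧
      ∀ p < n, ∃ d < q, s.arr 0 p = d + q * colour (p / m))

theorem halts_mainCase {n a b E q m : ℕ} {s : State} (hn : 0 < n) (hE : 0 < E) (hb : b ≤ E * a)
    (hE' : ∀ j, b ≤ j * a → E ≤ j) (h0 : s.reg 0 = n) (h1 : s.reg 1 = a) (h2 : s.reg 2 = b)
    (h3 : s.reg 3 = 1) (h4 : s.reg 4 = 0) (h40 : s.reg 40 = 0) (hq : q = 128 * (16 * E) ^ 3)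
    (hm : m = 8 * E * (Nat.log 2 n + 1)) :
    Halts mainCase (2500 * (q ^ m) ^ 7) (IsOutput E n q m) s := by
  have hm1 : 1 ≤ m := by rw [hm]; exact Nat.mul_pos (by omega) (by omega)
  have hEq : 16 * E ≤ q := by
    have := Nat.le_self_pow (show 3 ≠ 0 by norm_num) (16 * E)
    omega
  have hqQ : q ≤ (q ^ m) ^ 7 := by
    rw [← pow_mul]; exact Nat.le_self_pow (by omega) _
  apply Halts.mono
  · unfold mainCase
    apply halts_basic
    apply halts_cons
    · refine halts_loop (T := 3) (fun k s' => k = E - s'.reg 4 ∧ s'.reg 4 ≤ E ∧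
        s'.reg 14 = b - s'.reg 4 * a) E ?_ ?_
      · simp [h2, h4, h40]
      · rintro k s' ⟨hk, h4E, h14⟩ hne hfr
        have e1 := hfr.reg 1 (by decide)
        have e3 := hfr.reg 3 (by decide)
        simp [h1, h3] at e1 e3
        have hlt : s'.reg 4 < E := by
          by_contra hge
          have : E * a ≤ s'.reg 4 * a := Nat.mul_le_mul_right a (by omega)
          omega
        iterate 2 apply halts_basic
        apply halts_nil
        refine ⟨_, ?_, rfl, ?_, ?_⟩
        · simp [e3]; omega
        · simp [e3]; omega
        · simp [e3, e1, h14, Nat.add_mul]; omega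
    rintro s₁ ⟨hz, k, -, h4E, h14⟩ hfr₁
    -- The loop stops once `b ≤ s₁.reg 4 * a`; minimality of `E` excludes an earlier stop.
    have e4 : s₁.reg 4 = E := by
      have := hE' (s₁.reg 4) (by omega)
      omega
    have e0 := hfr₁.reg 0 (by decide)
    have e3 := hfr₁.reg 3 (by decide)
    have e40 := hfr₁.reg 40 (by decide)
    simp [h0, h3, h40] at e0 e3 e40
    apply halts_basic
    apply halts_cons
    · exact halts_mul (x := E) (y := 16) (by simp [e3]) (by simp [e40]) (by simp [e4]) (by simp)
        (by decide) (by decide)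
    intro s₂ f5 hfr₂
    have f0 := hfr₂.reg 0 (by decide)
    have f3 := hfr₂.reg 3 (by decide)
    have f4 := hfr₂.reg 4 (by decide)
    have f40 := hfr₂.reg 40 (by decide)
    simp [e0, e3, e4, e40] at f0 f3 f4 f40
    apply halts_cons
    · exact halts_mul f3 f40 f5 f5 (by decide) (by decide)
    intro s₃ g14 hfr₃
    have g0 := (hfr₃.reg 0 (by decide)).trans f0
    have g3 := (hfr₃.reg 3 (by decide)).trans f3
    have g4 := (hfr₃.reg 4 (by decide)).trans f4
    have g5 := (hfr₃.reg 5 (by decide)).trans f5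
    have g40 := (hfr₃.reg 40 (by decide)).trans f40
    apply halts_cons
    · exact halts_mul g3 g40 g14 g5 (by decide) (by decide)
    intro s₄ i7 hfr₄
    have i0 := (hfr₄.reg 0 (by decide)).trans g0
    have i3 := (hfr₄.reg 3 (by decide)).trans g3
    have i4 := (hfr₄.reg 4 (by decide)).trans g4
    have i5 := (hfr₄.reg 5 (by decide)).trans g5
    have i40 := (hfr₄.reg 40 (by decide)).trans g40
    apply halts_basic
    apply halts_cons
    · exact halts_mul (x := E * 16 * (E * 16) * (E * 16)) (y := 128) (by simp [i3]) (by simp [i40])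
        (by simp [i7]) (by simp) (by decide) (by decide)
    intro s₅ j6 hfr₅
    have j0 := hfr₅.reg 0 (by decide)
    have j3 := hfr₅.reg 3 (by decide)
    have j4 := hfr₅.reg 4 (by decide)
    have j5 := hfr₅.reg 5 (by decide)
    have j40 := hfr₅.reg 40 (by decide)
    simp [i0, i3, i4, i5, i40] at j0 j3 j4 j5 j40
    rw [show E * 16 * (E * 16) * (E * 16) * 128 = q by rw [hq]; ring] at j6
    apply halts_basic
    apply halts_cons (T₁ := 1000 * (q ^ m) ^ 7 + 1) (R := IsOutput E n q m)
    · refine halts_branch (fun hne => ?_) (fun hz => ?_)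
      · simp [j0, j6] at hne
        refine (halts_longCase (E := E) (n := n) (q := q) hE hn (by simp [j3]) (by simp [j40])
          (by simp [j0]) (by simp [j4]) (by simp [j5, mul_comm]) (by simp [j6]) hq rfl hm).imp ?_
        exact fun s' hs' => Or.inr ⟨by omega, hs'⟩
      · simp [j0, j6] at hz
        refine ((halts_shortCase (n := n) (by simp [j3]) (by simp [j40]) (by simp [j0])).mono ?_).imp
          ?_
        · omega
        · exact fun s' hs' => Or.inl ⟨by omega, hs'⟩
    intro s₆ hs₆ _
    exact halts_nil hs₆
  · omega

/-! ### Correctness of the program and the final estimates -/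

theorem succ_pow_three_le (L : ℕ) : (L + 1) ^ 3 ≤ 8 * (2 ^ L) ^ 2 := by
  induction L with
  | zero => norm_num
  | succ L ih =>
    rcases Nat.eq_zero_or_pos L with rfl | hL
    · norm_num
    · have h1 : (L + 1 + 1) ^ 3 ≤ 4 * (L + 1) ^ 3 := by
        obtain ⟨K, rfl⟩ := Nat.exists_eq_succ_of_ne_zero hL.ne'
        have : 4 * (K + 1 + 1) ^ 3 = (K + 1 + 1 + 1) ^ 3 + (3 * K ^ 3 + 15 * K ^ 2 + 21 * K + 5) := by
          ring
        exact this ▸ Nat.le_add_right _ _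
      have h2 : 8 * (2 ^ (L + 1)) ^ 2 = 4 * (8 * (2 ^ L) ^ 2) := by ring
      omega

/-- Long strings contain two full blocks because `E` is at most of order `n ^ (1 / 3)` and the
logarithm is at most of order `n ^ (2 / 3)`; the inequality is checked after cubing. -/
theorem two_mul_block_le {n E : ℕ} (hn : 128 * (16 * E) ^ 3 < n) :
    2 * (8 * E * (Nat.log 2 n + 1)) ≤ n := by
  have h1 : 2 ^ Nat.log 2 n ≤ n := Nat.pow_log_le_self 2 (by omega)
  have h2 := succ_pow_three_le (Nat.log 2 n)
  generalize Nat.log 2 n = L at h1 h2 ⊢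
  rw [← Nat.pow_le_pow_iff_left (n := 3) (by norm_num)]
  calc (2 * (8 * E * (L + 1))) ^ 3 = (16 * E) ^ 3 * (L + 1) ^ 3 := by ring
    _ ≤ (16 * E) ^ 3 * (8 * (2 ^ L) ^ 2) := Nat.mul_le_mul_left _ h2
    _ ≤ (16 * E) ^ 3 * (8 * n ^ 2) := by gcongr
    _ = (8 * (16 * E) ^ 3) * n ^ 2 := by ring
    _ ≤ n * n ^ 2 := Nat.mul_le_mul_right _ (by omega)
    _ = n ^ 3 := by ring

/-- At `n = 1` the logarithm vanishes and the time bound is a constant independent of `ε`, so the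
program must stop before it computes `E`. The initial zero in the array already is the output. -/
theorem constructs_of_eq_one {a b : ℕ} {ε : ℝ} {E : ℕ} (hE : 2 ≤ E) (hε : 1 / (E : ℝ) ≤ ε) :
    ∃ t ≤ 10, Constructs construct 1 a b ε 1 t := by
  have key : Halts construct 10 (fun s' => ∀ p < 1, s'.arr 0 p = p) (initState 1 a b) := by
    apply Halts.mono
    · unfold construct
      iterate 2 apply halts_basic
      apply halts_cons (T₁ := 2) (R := fun s' => ∀ p < 1, s'.arr 0 p = p)
      · refine halts_branch (T := 1) (fun hne => absurd ?_ hne) fun _ => halts_nil ?_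
        · simp [initState]
        · simp [initState]
      · exact fun s₁ h _ => halts_nil h
    · norm_num
  obtain ⟨t, s', hrun, ht, hs⟩ := key
  obtain ⟨S, h1, h2, h3⟩ := exists_circle_of_injective hE hε hs
  exact ⟨t, ht, s', hrun, S, h1, h2, h3⟩

theorem exists_constructs {n a b : ℕ} {ε : ℝ} {E : ℕ} (hn : 2 ≤ n) (hE : 2 ≤ E)
    (hε : 1 / (E : ℝ) ≤ ε) (hb : b ≤ E * a) (hE' : ∀ j, b ≤ j * a → E ≤ j) :
    ∃ q ≤ 3 * (128 * (16 * E) ^ 3),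
      ∃ t ≤ 3000 * ((128 * (16 * E) ^ 3) ^ (8 * E * (Nat.log 2 n + 1))) ^ 7,
        Constructs construct n a b ε q t := by
  set q := 128 * (16 * E) ^ 3 with hq
  set m := 8 * E * (Nat.log 2 n + 1) with hm
  have key : Halts construct (3000 * (q ^ m) ^ 7) (IsOutput E n q m) (initState n a b) := by
    apply Halts.mono
    · unfold construct
      iterate 2 apply halts_basic
      apply halts_cons (T₁ := 2500 * (q ^ m) ^ 7 + 1) (R := IsOutput E n q m)
      · refine halts_branch (fun _ => ?_) fun hz => ?_
        · exact halts_mainCase (by omega) (by omega) hb hE' (by simp [initState])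
            (by simp [initState]) (by simp [initState]) (by simp) (by simp [initState])
            (by simp [initState]) hq hm
        · simp [initState] at hz
          omega
      · exact fun s₁ h _ => halts_nil h
    · have : 1 ≤ (q ^ m) ^ 7 := Nat.one_le_pow _ _ (by positivity)
      omega
  obtain ⟨t, s', hrun, ht, hs⟩ := key
  rcases hs with ⟨hnq, hid⟩ | ⟨hqn, hB, hd⟩
  · obtain ⟨S, h1, h2, h3⟩ := exists_circle_of_injective hE hε hid
    exact ⟨n, by omega, t, ht, s', hrun, S, h1, h2, h3⟩
  · have hqpos : 0 < q := by positivity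
    have hblock : BlockString E n m (s'.arr 0) :=
      { pos := by rw [hm]; positivity
        le := two_mul_block_le hqn
        sync := fun T hT => (hB T hT).1
        far := fun S T hST hT => (hB T hT).2 S hST
        col := by
          intro u v hu hv huv
          obtain ⟨d, hd1, hd2⟩ := hd u hu
          obtain ⟨d', hd1', hd2'⟩ := hd v hv
          rw [hd2, hd2'] at huv
          have := congrArg (· / q) huv
          simpa [Nat.add_mul_div_left _ _ hqpos, Nat.div_eq_of_lt hd1, Nat.div_eq_of_lt hd1']
            using this }
    obtain ⟨S, h1, h2, h3⟩ := hblock.exists_circle (q := 3 * q) hE hε fun p hp => by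
      obtain ⟨d, hd1, hd2⟩ := hd p hp
      have hc : colour (p / m) ≤ 2 := by
        unfold colour; split_ifs <;> omega
      have := Nat.mul_le_mul_left q hc
      omega
    exact ⟨3 * q, le_rfl, t, ht, s', hrun, S, h1, h2, h3⟩

theorem Describes.exists_ceil {a b : ℕ} {ε : ℝ} (h : Describes a b ε) (hε : 0 < ε) (hε1 : ε < 1) :
    ∃ E : ℕ, 2 ≤ E ∧ 1 / (E : ℝ) ≤ ε ∧ (E : ℝ) ≤ 3 / ε ∧ b ≤ E * a ∧
      ∀ j, b ≤ j * a → E ≤ j := by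
  obtain ⟨hb, h1, h2⟩ := h
  have hbR : (0 : ℝ) < b := by exact_mod_cast hb
  rw [le_div_iff₀ hbR] at h1
  rw [div_le_iff₀ hbR] at h2
  have ha : 0 < a := by
    rcases Nat.eq_zero_or_pos a with rfl | ha
    · have : 0 < ε / 2 * b := by positivity
      simp at h1
      linarith
    · exact ha
  have haR : (0 : ℝ) < a := by exact_mod_cast ha
  have hex : ∃ j, b ≤ j * a := ⟨b, Nat.le_mul_of_pos_right b ha⟩
  set E := Nat.find hex with hE
  have hE1 : b ≤ E * a := Nat.find_spec hex
  have hE2 : ∀ j, b ≤ j * a → E ≤ j := fun j hj => Nat.find_min' hex hj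
  have hE1R : (b : ℝ) ≤ E * a := by exact_mod_cast hE1
  have hlt : 1 < E := by
    by_contra hle
    have hE1' : (E : ℝ) ≤ 1 := by exact_mod_cast not_lt.1 hle
    nlinarith
  have hER : (0 : ℝ) < E := by exact_mod_cast (by omega : 0 < E)
  refine ⟨E, hlt, ?_, ?_, hE1, hE2⟩
  · rw [div_le_iff₀ hER]
    by_contra hcon
    have hcon : ε * E < 1 := not_le.1 hcon
    nlinarith [mul_le_mul_of_nonneg_left h2 hER.le, mul_lt_mul_of_pos_right hcon hbR]
  · have hlast : (E - 1) * a < b := by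
      by_contra hcon
      have := hE2 (E - 1) (not_lt.1 hcon)
      omega
    have hlastR : ((E : ℝ) - 1) * a < b := by
      have : (((E - 1 : ℕ) : ℝ)) * a < b := by exact_mod_cast hlast
      rwa [Nat.cast_sub hlt.le, Nat.cast_one] at this
    rw [le_div_iff₀ hε]
    -- The `2` comes from the admissible factor `2` in `a / b`; adding `ε < 1` gives the constant
    -- `3`.
    have h3 : ((E : ℝ) - 1) * ε < 2 := by
      by_contra hcon
      have hcon : 2 ≤ ((E : ℝ) - 1) * ε := not_lt.1 hcon
      have hE0 : (0 : ℝ) ≤ (E : ℝ) - 1 := by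
        have : (1 : ℝ) ≤ E := by exact_mod_cast hlt.le
        linarith
      nlinarith [mul_le_mul_of_nonneg_left h1 hE0, mul_le_mul_of_nonneg_right hcon hbR.le]
    linarith

theorem alphabet_le {E : ℕ} {ε : ℝ} (hE : (E : ℝ) ≤ 3 / ε) :
    ((128 * (16 * E) ^ 3 : ℕ) : ℝ) ≤ 2 ^ 19 * 27 / ε ^ 3 := by
  have h : (E : ℝ) ^ 3 ≤ (3 / ε) ^ 3 := pow_le_pow_left₀ (Nat.cast_nonneg E) hE 3
  rw [div_pow] at h
  calc ((128 * (16 * E) ^ 3 : ℕ) : ℝ) = 2 ^ 19 * (E : ℝ) ^ 3 := by push_cast; ring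
    _ ≤ 2 ^ 19 * (3 ^ 3 / ε ^ 3) := by gcongr
    _ = 2 ^ 19 * 27 / ε ^ 3 := by ring

theorem natLog_succ_le {n : ℕ} (hn : 2 ≤ n) : ((Nat.log 2 n + 1 : ℕ) : ℝ) ≤ 3 * Real.log n := by
  have hl2 := Real.log_two_gt_d9
  have hn0 : (0 : ℝ) < n := by exact_mod_cast (by omega : 0 < n)
  have h1 : Real.log 2 ≤ Real.log n := Real.log_le_log (by norm_num) (by exact_mod_cast hn)
  have h2 : (Nat.log 2 n : ℝ) * Real.log 2 ≤ Real.log n := by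
    rw [← Real.log_pow]
    apply Real.log_le_log (by positivity)
    exact_mod_cast Nat.pow_log_le_self 2 (by omega)
  push_cast
  nlinarith

theorem time_le {n E : ℕ} {ε : ℝ} (hn : 2 ≤ n) (hε : 0 < ε) (hε1 : ε < 1)
    (hE : (E : ℝ) ≤ 3 / ε) :
    ((((128 * (16 * E) ^ 3) ^ (8 * E * (Nat.log 2 n + 1))) ^ 7 : ℕ) : ℝ) ≤
      (2 ^ 19 * 27 / ε ^ 2) ^ (1008 * (Real.log n / ε)) := by
  have hW := alphabet_le hE
  set W := 128 * (16 * E) ^ 3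
  set C : ℝ := 2 ^ 19 * 27 / ε ^ 2 with hC
  have hC1 : 1 ≤ C := by
    rw [hC, le_div_iff₀ (by positivity)]
    nlinarith
  -- The alphabet is cubic in `1 / ε` while the base of the time bound is quadratic; squaring the
  -- base compensates and doubles the exponent.
  have hWC : (W : ℝ) ≤ C ^ 2 := by
    refine hW.trans ?_
    rw [hC, div_pow, div_le_div_iff₀ (by positivity) (by positivity)]
    have h4 : (ε ^ 2) ^ 2 = ε ^ 3 * ε := by ring
    rw [h4]
    have h3 : 0 < ε ^ 3 := by positivity
    nlinarith [mul_lt_mul_of_pos_left hε1 h3]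
  have hh := natLog_succ_le hn
  set h := Nat.log 2 n + 1
  -- `1008 = 2 * 8 * 7 * 3 * 3`, the last two factors from `E ≤ 3 / ε` and `h ≤ 3 * Real.log n`.
  have hexp : ((2 * (8 * E * h * 7) : ℕ) : ℝ) ≤ 1008 * (Real.log n / ε) := by
    have : (E : ℝ) * h ≤ 3 / ε * (3 * Real.log n) := by gcongr
    calc ((2 * (8 * E * h * 7) : ℕ) : ℝ) = 112 * ((E : ℝ) * h) := by push_cast; ring
      _ ≤ 112 * (3 / ε * (3 * Real.log n)) := by gcongr
      _ = 1008 * (Real.log n / ε) := by ring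
  calc (((W ^ (8 * E * h)) ^ 7 : ℕ) : ℝ) = (W : ℝ) ^ (8 * E * h * 7) := by
        push_cast; rw [← pow_mul]
    _ ≤ (C ^ 2) ^ (8 * E * h * 7) := by gcongr
    _ = C ^ ((2 * (8 * E * h * 7) : ℕ) : ℝ) := by rw [Real.rpow_natCast, ← pow_mul]
    _ ≤ C ^ (1008 * (Real.log n / ε)) := Real.rpow_le_rpow_of_exponent_le hC1 hexp

/-- For bounded `E` the time is a constant raised to a multiple of `h`. Replacing the constant `W`
by `2 ^ W` turns it into a fixed power of `2 ^ h ≤ 2 * n`. -/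
theorem time_le_polynomial {n E E₀ : ℕ} (hn : 2 ≤ n) (hE : E ≤ E₀) :
    ((128 * (16 * E) ^ 3) ^ (8 * E * (Nat.log 2 n + 1))) ^ 7 ≤
      (2 * n) ^ (128 * (16 * E₀) ^ 3 * (56 * E₀)) := by
  have h1 : 2 ^ (Nat.log 2 n + 1) ≤ 2 * n := by
    have := Nat.pow_log_le_self 2 (x := n) (by omega)
    rw [pow_succ]; omega
  set W := 128 * (16 * E₀) ^ 3
  generalize Nat.log 2 n + 1 = h at *
  calc ((128 * (16 * E) ^ 3) ^ (8 * E * h)) ^ 7 = (128 * (16 * E) ^ 3) ^ (56 * E * h) := by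
        rw [← pow_mul]; congr 1; ring
    _ ≤ W ^ (56 * E * h) := by
        apply Nat.pow_le_pow_left
        exact Nat.mul_le_mul_left _ (Nat.pow_le_pow_left (by omega) 3)
    _ ≤ (2 ^ W) ^ (56 * E * h) := Nat.pow_le_pow_left Nat.lt_two_pow_self.le _
    _ ≤ (2 ^ W) ^ (56 * E₀ * h) := by
        apply Nat.pow_le_pow_right (by positivity)
        exact Nat.mul_le_mul_right _ (by omega)
    _ = (2 ^ h) ^ (W * (56 * E₀)) := by rw [← pow_mul, ← pow_mul]; congr 1; ring
    _ ≤ (2 * n) ^ (W * (56 * E₀)) := Nat.pow_le_pow_left h1 _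

end SyncCircle

theorem theorem4p5 :
    ∃ (P : SyncCircle.Prog) (A B D : ℝ) (p : Polynomial ℝ), 0 < A ∧ 0 < B ∧ 0 < D ∧
      (∀ n : ℕ, 1 ≤ n → ∀ ε : ℝ, 0 < ε → ε < 1 →
        ∀ a b : ℕ, SyncCircle.Describes a b ε →
          ∃ q t : ℕ, SyncCircle.Constructs P n a b ε q t ∧
            (q : ℝ) ≤ A / ε ^ 3 ∧
            (t : ℝ) ≤ (B / ε ^ 2) ^ (D * (Real.log (n : ℝ) / ε)) *
              p.eval (Real.log (n : ℝ) / ε)) ∧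
      (∀ ε : ℝ, 0 < ε → ε < 1 → ∃ r : Polynomial ℕ, ∀ n : ℕ, 1 ≤ n →
        ∀ a b : ℕ, SyncCircle.Describes a b ε →
          ∃ q t : ℕ, SyncCircle.Constructs P n a b ε q t ∧
            (q : ℝ) ≤ A / ε ^ 3 ∧ t ≤ r.eval n) := by
  have hone : ∀ ε : ℝ, 0 < ε → ε < 1 → ((1 : ℕ) : ℝ) ≤ 3 * (2 ^ 19 * 27) / ε ^ 3 := by
    intro ε hε hε1
    rw [le_div_iff₀ (by positivity)]
    have : ε ^ 3 ≤ 1 := pow_le_one₀ hε.le hε1.le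
    push_cast
    linarith
  have halph : ∀ (ε : ℝ) (E q : ℕ), (E : ℝ) ≤ 3 / ε → q ≤ 3 * (128 * (16 * E) ^ 3) →
      (q : ℝ) ≤ 3 * (2 ^ 19 * 27) / ε ^ 3 := by
    intro ε E q hE hq
    calc (q : ℝ) ≤ 3 * ((128 * (16 * E) ^ 3 : ℕ) : ℝ) := by exact_mod_cast hq
      _ ≤ 3 * (2 ^ 19 * 27 / ε ^ 3) := by gcongr; exact SyncCircle.alphabet_le hE
      _ = 3 * (2 ^ 19 * 27) / ε ^ 3 := by ring
  -- Here `2 ^ 19 = 128 * 16 ^ 3`, `27` comes from `E ^ 3 ≤ (3 / ε) ^ 3`, and the factor `3` in `A`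
  -- counts the colours. The seventh power of `q ^ m` is absorbed in the exponent, so a constant
  -- polynomial suffices.
  refine ⟨SyncCircle.construct, 3 * (2 ^ 19 * 27), 2 ^ 19 * 27, 1008, Polynomial.C 3000,
    by norm_num, by norm_num, by norm_num, ?_, ?_⟩
  · intro n hn ε hε hε1 a b hab
    obtain ⟨E, hE2, hEε, hE3, hb, hE'⟩ := hab.exists_ceil hε hε1
    rw [Polynomial.eval_C]
    rcases Nat.lt_or_ge n 2 with h | h
    · obtain rfl : n = 1 := by omega
      obtain ⟨t, ht, hcon⟩ := SyncCircle.constructs_of_eq_one (a := a) (b := b) hE2 hEε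
      refine ⟨1, t, hcon, hone ε hε hε1, ?_⟩
      have : (t : ℝ) ≤ 10 := by exact_mod_cast ht
      simp only [Nat.cast_one, Real.log_one, zero_div, mul_zero, Real.rpow_zero]
      linarith
    · obtain ⟨q, hq, t, ht, hcon⟩ := SyncCircle.exists_constructs h hE2 hEε hb hE'
      refine ⟨q, t, hcon, halph ε E q hE3 hq, ?_⟩
      have h1 : (t : ℝ) ≤ 3000 *
          ((((128 * (16 * E) ^ 3) ^ (8 * E * (Nat.log 2 n + 1))) ^ 7 : ℕ) : ℝ) := by
        exact_mod_cast ht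
      have h2 := SyncCircle.time_le h hε hε1 hE3
      linarith
  · intro ε hε hε1
    -- The polynomial may depend on `ε` but not on `a` and `b`, so it uses this common bound for all
    -- values of `E`.
    set E₀ := ⌈3 / ε⌉₊
    refine ⟨3000 * (2 * Polynomial.X) ^ (128 * (16 * E₀) ^ 3 * (56 * E₀)), fun n hn a b hab => ?_⟩
    have heval : Polynomial.eval n
        ((3000 : Polynomial ℕ) * (2 * Polynomial.X) ^ (128 * (16 * E₀) ^ 3 * (56 * E₀))) =
        3000 * (2 * n) ^ (128 * (16 * E₀) ^ 3 * (56 * E₀)) := by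
      simp
    rw [heval]
    obtain ⟨E, hE2, hEε, hE3, hb, hE'⟩ := hab.exists_ceil hε hε1
    rcases Nat.lt_or_ge n 2 with h | h
    · obtain rfl : n = 1 := by omega
      obtain ⟨t, ht, hcon⟩ := SyncCircle.constructs_of_eq_one (a := a) (b := b) hE2 hEε
      refine ⟨1, t, hcon, hone ε hε hε1, ?_⟩
      have : 1 ≤ (2 * 1) ^ (128 * (16 * E₀) ^ 3 * (56 * E₀)) := Nat.one_le_pow _ _ (by norm_num)
      omega
    · obtain ⟨q, hq, t, ht, hcon⟩ := SyncCircle.exists_constructs h hE2 hEε hb hE'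
      refine ⟨q, t, hcon, halph ε E q hE3 hq, ht.trans (Nat.mul_le_mul_left _ ?_)⟩
      refine SyncCircle.time_le_polynomial h ?_
      exact_mod_cast hE3.trans (Nat.le_ceil _)
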